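/- Let $T,\varepsilon_0>0$, let $D\subset\mathbb R^n$ be open, let $k\ge 0$ be an integer, and consider $$x'=\sum_{i=1}^k\varepsilon^iF_i(t,x)+\varepsilon^{k+1}R(t,x,\varepsilon),\qquad (t,x,\varepsilon)\in\mathbb R\times D\times[0,\varepsilon_0],\tag{1}$$ where the $F_i:\mathbb R\times D\to\mathbb R^n$ are $C^\infty$, $R:\mathbb R\times D\times[0,\varepsilon_0]\to\mathbb R^n$ is continuous, and all of them are $T$-periodic in $t$. *Melnikov functions.* For $1\le i\le k$ let $\mathbf f_i(z)=y_i(T,z)/i!$, where $$y_i(t,z)=\int_0^t\Big(i!\,F_i(s,z)+\sum_{j=1}^{i-1}\sum_{m=1}^{j}\frac{i!}{j!}\,\partial_x^mF_{i-j}(s,z)\,B_{j,m}\big(y_1,\dots,y_{j-m+1}\big)(s,z)\Big)ds$$ and $B_{j,m}$ are the partial Bell polynomials (a product of $m$ vectors being the argument of the symmetric $m$-linear map $\partial_x^mF_{i-j}(s,z)$). *Stroboscopic averaged functions.* Functions $\mathbf g_1,\dots,\mathbf g_k\in C^\infty(D,\mathbb R^n)$ are called stroboscopic averaged functions of (1)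 if there are $C^\infty$ functions $u_i:\mathbb R\times D\to\mathbb R^n$, $1\le i\le k$, $T$-periodic in $t$, such that $U(t,z,\varepsilon)=z+\sum_{i=1}^k\varepsilon^iu_i(t,z)$ satisfies $U(0,z,\varepsilon)=z$ and the change of variables $x=U(t,z,\varepsilon)$ transforms (1) into $z'=\sum_{i=1}^k\varepsilon^i\mathbf g_i(z)+\varepsilon^{k+1}r(t,z,\varepsilon)$, i.e. for every compact $K\subset D$ there is $\varepsilon_1\in(0,\varepsilon_0]$ such that, for $t\in\mathbb R$, $z\in K$, $\varepsilon\in[0,\varepsilon_1]$, one has $U(t,z,\varepsilon)\in D$, $r$ is bounded, and $$\partial_tU+\partial_zU\cdot\Big(\sum_{i=1}^k\varepsilon^i\mathbf g_i(z)+\varepsilon^{k+1}r\Big)=\sum_{i=1}^k\varepsilon^iF_i(t,U)+\varepsilon^{k+1}R(t,U,\varepsilon).$$ **Proposition.** Stroboscopic averaged functions of (1) exist, and any such $\mathbf g_1,\dots,\mathbf g_k$ have the following property. Let $\ell\in\{2,\dots,k\}$, and suppose that either $\mathbf f_1=\dots=\mathbf f_{\ell-1}=0$ on $D$ or $\mathbf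 g_1=\dots=\mathbf g_{\ell-1}=0$ on $D$. Then $\mathbf f_i=T\,\mathbf g_i$ on $D$ for every $i\in\{1,\dots,2\ell-1\}$ with $i\le k$. Moreover, if $2\ell\le k$, then for every $z\in D$ $$\mathbf g_{2\ell}(z)=\frac1T\Big(\mathbf f_{2\ell}(z)-\frac12\,d\mathbf f_\ell(z)\cdot\mathbf f_\ell(z)\Big)\quad\text{and}\quad \mathbf f_{2\ell}(z)=T\,\mathbf g_{2\ell}(z)+\frac{T^2}{2}\,d\mathbf g_\ell(z)\cdot\mathbf g_\ell(z).$$ -/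

import Mathlib

open Set
open scoped Nat ContDiff

noncomputable section

/-- The partial Bell polynomial `B_{j,m}(y_1, …, y_{j-m+1})`, written out as the sum over all
partitions of a `j`-element set into `m` blocks of the products of the `y_q`, one factor `y_q` for
each block of size `q`. The `y_q` are vectors and a product of `m` vectors stands for the argument
of a symmetric `m`-linear map, here the term `p m` of the sequence `p` of multilinear maps; so this
is `p m · B_{j,m}(y_1, …, y_{j-m+1})`. (`OrderedFinpartition j` lists each partition of `Fin j`
exactly once, its blocks being sorted by their greatest elements.) -/
def bellApply {E : Type*} [NormedAddCommGroup E] [NormedSpace ℝ E] (j m : ℕ)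
    (p : FormalMultilinearSeries ℝ E E) (y : ℕ → E) : E :=
  ∑ c : OrderedFinpartition j with c.length = m, p c.length fun b => y (c.partSize b)

/-- The functions `y_i(t, z)`:
`y_i(t,z) = ∫_0^t ( i! F_i(s,z) + ∑_{j=1}^{i-1} ∑_{m=1}^{j} (i!/j!) ∂_x^m F_{i-j}(s,z)
  B_{j,m}(y_1, …, y_{j-m+1})(s,z) ) ds`, for `i ≥ 1`.
The guard `q < i` is only there for the recursion: merely the `y_q` with
`1 ≤ q ≤ j - m + 1 < i` enter the Bell polynomial. -/
def melnikovY {n : ℕ} (F : ℕ → ℝ → EuclideanSpace ℝ (Fin n) → EuclideanSpace ℝ (Fin n))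
    (i : ℕ) (t : ℝ) (z : EuclideanSpace ℝ (Fin n)) : EuclideanSpace ℝ (Fin n) :=
  ∫ s in (0 : ℝ)..t,
    ((i ! : ℝ) • F i s z +
      ∑ j ∈ Finset.Icc 1 (i - 1), ∑ m ∈ Finset.Icc 1 j,
        ((i ! : ℝ) / (j ! : ℝ)) •
          bellApply j m (ftaylorSeries ℝ (F (i - j) s) z)
            (fun q => if _h : q < i then melnikovY F q s z else 0))
termination_by i

/-- The Melnikov function `f_i(z) = y_i(T, z) / i!` of order `i`. -/
def melnikov {n : ℕ} (T : ℝ)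
    (F : ℕ → ℝ → EuclideanSpace ℝ (Fin n) → EuclideanSpace ℝ (Fin n))
    (i : ℕ) (z : EuclideanSpace ℝ (Fin n)) : EuclideanSpace ℝ (Fin n) :=
  (1 / (i ! : ℝ)) • melnikovY F i T z

/-- The right-hand side `∑_{i=1}^k ε^i F_i(t,x) + ε^{k+1} R(t,x,ε)` of the perturbed equation. -/
def perturbedField {n : ℕ} (k : ℕ)
    (F : ℕ → ℝ → EuclideanSpace ℝ (Fin n) → EuclideanSpace ℝ (Fin n))
    (R : ℝ → EuclideanSpace ℝ (Fin n) → ℝ → EuclideanSpace ℝ (Fin n))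
    (t : ℝ) (x : EuclideanSpace ℝ (Fin n)) (ε : ℝ) : EuclideanSpace ℝ (Fin n) :=
  ∑ i ∈ Finset.Icc 1 k, ε ^ i • F i t x + ε ^ (k + 1) • R t x ε

/-- The near-identity map `U(t,z,ε) = z + ∑_{i=1}^k ε^i u_i(t,z)`. -/
def nearIdentity {n : ℕ} (k : ℕ)
    (u : ℕ → ℝ → EuclideanSpace ℝ (Fin n) → EuclideanSpace ℝ (Fin n))
    (t : ℝ) (z : EuclideanSpace ℝ (Fin n)) (ε : ℝ) : EuclideanSpace ℝ (Fin n) :=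
  z + ∑ i ∈ Finset.Icc 1 k, ε ^ i • u i t z

/-- `x = U(t,z,ε) = z + ∑_{i=1}^k ε^i u_i(t,z)` is a smooth `T`-periodic stroboscopic near-identity
transformation which carries `x' = ∑_{i=1}^k ε^i F_i(t,x) + ε^{k+1} R(t,x,ε)` into
`z' = ∑_{i=1}^k ε^i g_i(z) + ε^{k+1} r(t,z,ε)`, with smooth `g_i` and with a remainder `r` that is
bounded for `z` in compact subsets of `D` and small `ε`. -/
structure IsStroboscopicTransformation {n : ℕ} (T ε₀ : ℝ) (D : Set (EuclideanSpace ℝ (Fin n)))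
    (k : ℕ) (F : ℕ → ℝ → EuclideanSpace ℝ (Fin n) → EuclideanSpace ℝ (Fin n))
    (R : ℝ → EuclideanSpace ℝ (Fin n) → ℝ → EuclideanSpace ℝ (Fin n))
    (u : ℕ → ℝ → EuclideanSpace ℝ (Fin n) → EuclideanSpace ℝ (Fin n))
    (g : ℕ → EuclideanSpace ℝ (Fin n) → EuclideanSpace ℝ (Fin n)) : Prop where
  smooth_u : ∀ i ∈ Finset.Icc 1 k,
    ContDiffOn ℝ ∞ (fun p : ℝ × EuclideanSpace ℝ (Fin n) => u i p.1 p.2) (univ ×ˢ D)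
  smooth_g : ∀ i ∈ Finset.Icc 1 k, ContDiffOn ℝ ∞ (g i) D
  periodic : ∀ i ∈ Finset.Icc 1 k, ∀ t : ℝ, ∀ z ∈ D, u i (t + T) z = u i t z
  /-- The stroboscopic condition `U(0,z,ε) = z`. -/
  stroboscopic : ∀ z ∈ D, ∀ ε ∈ Icc 0 ε₀, nearIdentity k u 0 z ε = z
  /-- If `z(t)` solves the averaged equation, then `x(t) = U(t, z(t), ε)` solves the given one:
  `∂_t U + ∂_z U · (∑ ε^i g_i + ε^{k+1} r) = ∑ ε^i F_i(t,U) + ε^{k+1} R(t,U,ε)`. -/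
  transforms : ∃ r : ℝ → EuclideanSpace ℝ (Fin n) → ℝ → EuclideanSpace ℝ (Fin n),
    ∀ K ⊆ D, IsCompact K → ∃ ε₁ ∈ Ioc 0 ε₀, ∃ C : ℝ, ∀ t : ℝ, ∀ z ∈ K, ∀ ε ∈ Icc 0 ε₁,
      nearIdentity k u t z ε ∈ D ∧ ‖r t z ε‖ ≤ C ∧
      deriv (fun s => nearIdentity k u s z ε) t +
          fderiv ℝ (fun w => nearIdentity k u t w ε) z
            (∑ i ∈ Finset.Icc 1 k, ε ^ i • g i z + ε ^ (k + 1) • r t z ε) =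
        perturbedField k F R t (nearIdentity k u t z ε) ε

/-- `g_1, …, g_k` are the stroboscopic averaged functions, up to order `k`, of the equation
`x' = ∑_{i=1}^k ε^i F_i(t,x) + ε^{k+1} R(t,x,ε)` on `D`. -/
def IsStroboscopicAveraged {n : ℕ} (T ε₀ : ℝ) (D : Set (EuclideanSpace ℝ (Fin n)))
    (k : ℕ) (F : ℕ → ℝ → EuclideanSpace ℝ (Fin n) → EuclideanSpace ℝ (Fin n))
    (R : ℝ → EuclideanSpace ℝ (Fin n) → ℝ → EuclideanSpace ℝ (Fin n))
    (g : ℕ → EuclideanSpace ℝ (Fin n) → EuclideanSpace ℝ (Fin n)) : Prop :=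
  ∃ u, IsStroboscopicTransformation T ε₀ D k F R u g

end

open Filter Asymptotics Topology MeasureTheory

/-! Both families of functions describe the same time-`T` map. By Faà di Bruno, the recursion for
`y_i` is the order-by-order integration of the perturbed equation, so `z + ∑ ε^i y_i(t,z)/i!` is the
truncated expansion of the solution issued from `z` (`sum_bellApply_melnikovY`,
`melnikovExpansion_residual_isLittleO`).

On the averaged side, suppose `g_1, …, g_{ℓ-1}` vanish. Then the solution of `z' = ∑ ε^i g_i(z)`
moves by `ε^ℓ t g_ℓ(z) + o(ε^ℓ)`. Feeding this back into the field leaves every `g_i` unchanged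
through order `2ℓ - 1` and at order `2ℓ` adds only `t dg_ℓ·g_ℓ`. Integrating gives the coefficients
`t g_i`, with the extra `(t²/2) dg_ℓ·g_ℓ` at order `2ℓ` (`averagedExpansion_residual_isLittleO`).

Let `Z(t,ε)` be that truncated averaged solution. Then `U(t, Z(t,ε), ε)` solves the original
equation up to `O(ε^{N+1})`, where `N = min(k, 2ℓ)`, and starts at `z`. Grönwall shows that it
agrees with the Melnikov expansion up to `o(ε^N)` (`sub_melnikovExpansion_isLittleO`). Periodicity
and `U(0,·,ε) = id` give `U(T,·,ε) = id`, so at time `T` the transformation drops out and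
coefficients can be compared (`melnikov_eq_averagedCoeff`). No exact flow is ever needed, only
approximate solutions with small defect.

If the vanishing is assumed for the `f_i` instead, the same comparison transfers it to the `g_i` one
index at a time.

Existence is classical averaging: at each order the `T`-periodic defect is split into its mean,
which goes into `g`, and a zero-mean part, whose primitive is periodic and goes into `u`
(`exists_averagingResidual_isLittleO`). The remainder `r` is then found by inverting `∂_z U`, which
is close to the identity. -/

/-! ### One-sided Taylor expansions in `ε`, uniform in parameters. -/

theorem ContDiffOn.deriv_snd {X G : Type*} [NormedAddCommGroup X] [NormedSpace ℝ X]
    [NormedAddCommGroup G] [NormedSpace ℝ G] {P : X × ℝ → G} {W : Set (X × ℝ)} (hW : IsOpen W)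
    (hP : ContDiffOn ℝ ∞ P W) :
    ContDiffOn ℝ ∞ (fun q : X × ℝ => deriv (fun e => P (q.1, e)) q.2) W := by
  have h1 : ContDiffOn ℝ ∞ (fun q => fderiv ℝ P q (0, 1)) W :=
    (hP.fderiv_of_isOpen hW (by simp)).clm_apply contDiffOn_const
  refine h1.congr fun q hq => ?_
  have h2 : HasFDerivAt P (fderiv ℝ P q) (q.1, q.2) :=
    ((hP.contDiffAt (hW.mem_nhds hq)).differentiableAt (by simp)).hasFDerivAt
  exact (h2.comp_hasDerivAt q.2 ((hasDerivAt_const q.2 q.1).prodMk (hasDerivAt_id q.2))).deriv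

theorem ContDiffOn.iteratedDeriv_snd {X G : Type*} [NormedAddCommGroup X] [NormedSpace ℝ X]
    [NormedAddCommGroup G] [NormedSpace ℝ G] {P : X × ℝ → G} {W : Set (X × ℝ)} (hW : IsOpen W)
    (hP : ContDiffOn ℝ ∞ P W) (j : ℕ) :
    ContDiffOn ℝ ∞ (fun q : X × ℝ => iteratedDeriv j (fun e => P (q.1, e)) q.2) W := by
  induction j with
  | zero => simpa using hP
  | succ j ih =>
    simp only [iteratedDeriv_succ]
    exact ih.deriv_snd hW

/-- The top term is itself `o(ε^N)` for the next lower `N`, so removing it lets induction kill the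
lower coefficients; what remains is `ε^(N+1) a = o(ε^(N+1))`. The filter is one-sided because the
equation only makes sense for `ε ≥ 0`. -/
theorem eq_zero_of_sum_pow_smul_isLittleO {G : Type*} [NormedAddCommGroup G] [NormedSpace ℝ G]
    (a : ℕ → G) (N : ℕ)
    (h : (fun ε : ℝ => ∑ i ∈ Finset.range (N + 1), ε ^ i • a i) =o[𝓝[>] 0] fun ε => ε ^ N) :
    ∀ i ≤ N, a i = 0 := by
  induction N with
  | zero =>
    intro i hi
    obtain rfl : i = 0 := by omega
    simpa using h
  | succ N ih =>
    have h0 : ∀ i ≤ N, a i = 0 := by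
      refine ih ?_
      have h1 : (fun ε : ℝ => ε ^ (N + 1)) =o[𝓝[>] 0] fun ε => ε ^ N :=
        (isLittleO_pow_pow (Nat.lt_succ_self N)).mono nhdsWithin_le_nhds
      have h2 : (fun ε : ℝ => ε ^ (N + 1) • a (N + 1)) =o[𝓝[>] 0] fun ε => ε ^ N := by
        have := h1.smul_isBigO (isBigO_refl (fun _ : ℝ => a (N + 1)) (𝓝[>] 0))
        exact this.trans_isBigO (IsBigO.of_bound ‖a (N + 1)‖
          (Eventually.of_forall fun ε => by rw [norm_smul, mul_comm]))
      refine ((h.trans h1).sub h2).congr_left fun ε => ?_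
      rw [Finset.sum_range_succ _ (N + 1)]; abel
    have h3 : (fun ε : ℝ => ε ^ (N + 1) • a (N + 1)) =o[𝓝[>] 0] fun ε => ε ^ (N + 1) := by
      refine h.congr_left fun ε => ?_
      rw [Finset.sum_range_succ, Finset.sum_eq_zero, zero_add]
      intro i hi
      rw [h0 i (by simpa [Nat.lt_succ_iff] using hi), smul_zero]
    have h4 : a (N + 1) = 0 := by
      rw [isLittleO_iff] at h3
      by_contra hne
      have hpos : 0 < ‖a (N + 1)‖ := norm_pos_iff.mpr hne
      obtain ⟨ε, hε, hε0⟩ := ((h3 (half_pos hpos)).and self_mem_nhdsWithin).exists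
      have hp : 0 < ‖ε ^ (N + 1)‖ := norm_pos_iff.mpr (pow_ne_zero _ (ne_of_gt hε0))
      rw [norm_smul, mul_comm] at hε
      nlinarith [mul_pos hpos hp]
    intro i hi
    rcases Nat.le_succ_iff.mp hi with h | h
    · exact h0 i h
    · rw [h]; exact h4

theorem ContDiffAt.sub_sum_iteratedDeriv_isLittleO {G : Type*} [NormedAddCommGroup G]
    [NormedSpace ℝ G] {f : ℝ → G} (hf : ContDiffAt ℝ ∞ f 0) (m : ℕ) :
    (fun ε : ℝ => f ε - ∑ j ∈ Finset.range (m + 1), ε ^ j • ((j ! : ℝ)⁻¹ • iteratedDeriv j f 0))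
      =o[𝓝[>] 0] fun ε => ε ^ m := by
  obtain ⟨u, hu, hfu⟩ := (hf.of_le (show ((m : ℕ∞ω)) ≤ ∞ by exact_mod_cast le_top)).contDiffOn
    le_rfl (by simp)
  obtain ⟨δ, hδ, hδu⟩ := Metric.mem_nhds_iff.mp hu
  have hb : IsOpen (Metric.ball (0 : ℝ) δ) := Metric.isOpen_ball
  have h0 : (0 : ℝ) ∈ Metric.ball (0 : ℝ) δ := Metric.mem_ball_self hδ
  have h := taylor_isLittleO (convex_ball (0 : ℝ) δ) h0 (hfu.mono hδu)
  rw [hb.nhdsWithin_eq h0] at h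
  refine (h.mono (nhdsWithin_le_nhds (s := Ioi 0))).congr (fun ε => ?_) (fun ε => by simp)
  rw [taylor_within_apply]
  congr 1
  refine Finset.sum_congr rfl fun j hj => ?_
  rw [iteratedDerivWithin_of_isOpen hb h0, smul_smul, sub_zero, mul_comm]

theorem iteratedDeriv_eq_zero_of_isLittleO {G : Type*} [NormedAddCommGroup G]
    [NormedSpace ℝ G] {f : ℝ → G} (hf : ContDiffAt ℝ ∞ f 0) {m : ℕ}
    (h : f =o[𝓝[>] 0] fun ε : ℝ => ε ^ m) : ∀ j ≤ m, iteratedDeriv j f 0 = 0 := by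
  intro j hj
  have := eq_zero_of_sum_pow_smul_isLittleO (fun j => (j ! : ℝ)⁻¹ • iteratedDeriv j f 0) m
    ((h.sub (hf.sub_sum_iteratedDeriv_isLittleO m)).congr_left fun ε => by simp) j hj
  simpa [Nat.factorial_ne_zero] using this

theorem isLittleO_leading_term {G : Type*} [NormedAddCommGroup G]
    [NormedSpace ℝ G] {f : ℝ → G} (hf : ContDiffAt ℝ ∞ f 0) {m : ℕ}
    (h : f =o[𝓝[>] 0] fun ε : ℝ => ε ^ m) :
    (fun ε : ℝ => f ε - ε ^ (m + 1) • (((m + 1)! : ℝ)⁻¹ • iteratedDeriv (m + 1) f 0))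
      =o[𝓝[>] 0] fun ε => ε ^ (m + 1) := by
  refine (hf.sub_sum_iteratedDeriv_isLittleO (m + 1)).congr_left fun ε => ?_
  rw [Finset.sum_range_succ, Finset.sum_eq_zero, zero_add]
  intro j hj
  rw [iteratedDeriv_eq_zero_of_isLittleO hf h j (by simpa [Nat.lt_succ_iff] using hj)]
  simp

theorem exists_Icc_subset_of_isCompact {X : Type*} [TopologicalSpace X] {K : Set X}
    (hK : IsCompact K) {W : Set (X × ℝ)} (hW : IsOpen W) (hKW : ∀ p ∈ K, (p, (0 : ℝ)) ∈ W) :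
    ∃ δ > 0, ∀ p ∈ K, ∀ ε ∈ Icc 0 δ, (p, ε) ∈ W := by
  obtain ⟨U, V, hU, hV, hKU, h0V, hUV⟩ := generalized_tube_lemma hK
    (isCompact_singleton (x := (0 : ℝ))) hW (by rintro ⟨p, e⟩ ⟨hp, rfl⟩; exact hKW p hp)
  obtain ⟨δ, hδ, hδV⟩ := Metric.isOpen_iff.mp hV 0 (h0V rfl)
  refine ⟨δ / 2, half_pos hδ, fun p hp ε hε => hUV ⟨hKU hp, hδV ?_⟩⟩
  rw [Metric.mem_ball, dist_zero_right, Real.norm_eq_abs, abs_of_nonneg hε.1]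
  linarith [hε.2]

/-- A smooth family of functions of `ε` which is pointwise `o(ε^m)` is `O(ε^(m+1))`, uniformly on
compact sets of parameters. -/
theorem exists_uniform_bound_of_isLittleO {X G : Type*} [NormedAddCommGroup X] [NormedSpace ℝ X]
    [NormedAddCommGroup G] [NormedSpace ℝ G] {P : X × ℝ → G} {W : Set (X × ℝ)} (hW : IsOpen W)
    (hP : ContDiffOn ℝ ∞ P W) {K : Set X} (hK : IsCompact K) (hKW : ∀ p ∈ K, (p, (0 : ℝ)) ∈ W)
    {m : ℕ} (h : ∀ p ∈ K, (fun ε => P (p, ε)) =o[𝓝[>] 0] fun ε : ℝ => ε ^ m) :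
    ∃ δ > 0, ∃ C : ℝ, ∀ p ∈ K, ∀ ε ∈ Icc 0 δ, (p, ε) ∈ W ∧ ‖P (p, ε)‖ ≤ C * ε ^ (m + 1) := by
  obtain ⟨δ, hδ, hδW⟩ := exists_Icc_subset_of_isCompact hK hW hKW
  have hsub : K ×ˢ Icc 0 δ ⊆ W := fun q hq => hδW q.1 hq.1 q.2 hq.2
  -- All Taylor coefficients up to order `m` vanish, so the Lagrange-type remainder, controlled by
  -- the `(m+1)`-st `ε`-derivative on a compact set, bounds the whole function.
  obtain ⟨C, hC⟩ := (hK.prod (isCompact_Icc (a := (0 : ℝ)) (b := δ))).exists_bound_of_continuousOn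
    ((hP.iteratedDeriv_snd hW (m + 1)).continuousOn.mono hsub)
  refine ⟨δ, hδ, C / (m ! : ℝ), fun p hp ε hε => ⟨hδW p hp ε hε, ?_⟩⟩
  have hs : ∀ e ∈ Icc 0 δ, ContDiffAt ℝ ∞ (fun e => P (p, e)) e := fun e he =>
    (hP.contDiffAt (hW.mem_nhds (hδW p hp e he))).comp e
      (contDiffAt_const.prodMk contDiffAt_id)
  have hle : ∀ j : ℕ, ((j : ℕ∞ω)) ≤ ∞ := fun j => by exact_mod_cast le_top
  have hu := uniqueDiffOn_Icc hδ
  have h0 : (0 : ℝ) ∈ Icc 0 δ := ⟨le_rfl, hδ.le⟩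
  have ht := taylor_mean_remainder_bound (f := fun e => P (p, e)) (n := m) (C := C) hδ.le
    (fun e he => ((hs e he).of_le (by exact_mod_cast hle (m + 1))).contDiffWithinAt) hε
    (fun y hy => by
      rw [iteratedDerivWithin_eq_iteratedDeriv hu ((hs y hy).of_le (hle _)) hy]
      exact hC (p, y) ⟨hp, hy⟩)
  rw [taylor_within_apply, Finset.sum_eq_zero, sub_zero, sub_zero] at ht
  · rw [div_mul_eq_mul_div]; exact ht
  · intro j hj
    rw [iteratedDerivWithin_eq_iteratedDeriv hu ((hs 0 h0).of_le (hle _)) h0,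
      iteratedDeriv_eq_zero_of_isLittleO (hs 0 h0) (h p hp) j
        (by simpa [Nat.lt_succ_iff] using hj), smul_zero]

/-! ### Smooth dependence of integrals on parameters and endpoints. -/

theorem continuousOn_intervalIntegral_param {X G : Type} [NormedAddCommGroup X]
    [NormedSpace ℝ X] [NormedAddCommGroup G] [NormedSpace ℝ G]
    {Ω : Set X} {c : X × ℝ → G}
    (hc : ContinuousOn c (Ω ×ˢ univ)) (a b : ℝ) :
    ContinuousOn (fun p => ∫ s in a..b, c (p, s)) Ω := by
  rw [continuousOn_iff_continuous_domRestrict]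
  refine intervalIntegral.continuous_parametric_intervalIntegral_of_continuous'
    (f := fun (p : Ω) s => c (p, s)) ?_ a b
  exact hc.comp_continuous (by fun_prop) (fun q => ⟨q.1.2, mem_univ _⟩)

theorem hasFDerivAt_intervalIntegral_param {X G : Type} [NormedAddCommGroup X]
    [NormedSpace ℝ X] [ProperSpace X] [NormedAddCommGroup G] [NormedSpace ℝ G]
    {Ω : Set X} (hΩ : IsOpen Ω) {c : X × ℝ → G}
    (hc : ContDiffOn ℝ 1 c (Ω ×ˢ univ)) (a b : ℝ) {p : X} (hp : p ∈ Ω) :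
    HasFDerivAt (fun p => ∫ s in a..b, c (p, s))
      (∫ s in a..b, (fderiv ℝ c (p, s)).comp (ContinuousLinearMap.inl ℝ X ℝ)) p := by
  have hW : IsOpen (Ω ×ˢ (univ : Set ℝ)) := hΩ.prod isOpen_univ
  have hd : ContinuousOn (fun q : X × ℝ => (fderiv ℝ c q).comp (ContinuousLinearMap.inl ℝ X ℝ))
      (Ω ×ˢ univ) :=
    (hc.continuousOn_fderiv_of_isOpen hW le_rfl).clm_comp continuousOn_const
  obtain ⟨δ, hδ, hδΩ⟩ := Metric.nhds_basis_closedBall.mem_iff.mp (hΩ.mem_nhds hp)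
  obtain ⟨C, hC⟩ := ((isCompact_closedBall p δ).prod
    (isCompact_uIcc (a := a) (b := b))).exists_bound_of_continuousOn
    (hd.mono (prod_mono hδΩ (subset_univ _)))
  have hcs : ∀ x ∈ Ω, Continuous fun s => c (x, s) := fun x hx =>
    hc.continuousOn.comp_continuous (by fun_prop) (fun s => ⟨hx, mem_univ _⟩)
  have hds : ∀ x ∈ Ω, Continuous fun s =>
      (fderiv ℝ c (x, s)).comp (ContinuousLinearMap.inl ℝ X ℝ) := fun x hx =>
    hd.comp_continuous (f := fun s => (x, s)) (by fun_prop) (fun s => ⟨hx, mem_univ _⟩)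
  refine intervalIntegral.hasFDerivAt_integral_of_dominated_of_fderiv_le (bound := fun _ => C)
    (F' := fun x s => (fderiv ℝ c (x, s)).comp (ContinuousLinearMap.inl ℝ X ℝ))
    (Metric.closedBall_mem_nhds p hδ) ?_ ((hcs p hp).intervalIntegrable a b)
    (hds p hp).aestronglyMeasurable ?_ (by simp) ?_
  · filter_upwards [hΩ.mem_nhds hp] with x hx using (hcs x hx).aestronglyMeasurable
  · exact Eventually.of_forall fun s hs x hx => hC (x, s) ⟨hx, uIoc_subset_uIcc hs⟩
  · refine Eventually.of_forall fun s hs x hx => ?_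
    have h1 : HasFDerivAt c (fderiv ℝ c (x, s)) (x, s) :=
      ((hc.contDiffAt (hW.mem_nhds ⟨hδΩ hx, mem_univ _⟩)).differentiableAt (by simp)).hasFDerivAt
    exact h1.comp x (hasFDerivAt_prodMk_left x s)

/-- The induction quantifies over the target `G`, because differentiating under the integral
replaces `G` by `X →L[ℝ] G`; keeping both spaces in one universe makes the induction hypothesis
apply to it. -/
theorem contDiffOn_nat_intervalIntegral_param {X : Type} [NormedAddCommGroup X]
    [NormedSpace ℝ X] [ProperSpace X] {Ω : Set X} (hΩ : IsOpen Ω) (a b : ℝ) (m : ℕ) :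
    ∀ {G : Type} [NormedAddCommGroup G] [NormedSpace ℝ G] {c : X × ℝ → G},
      ContDiffOn ℝ m c (Ω ×ˢ univ) → ContDiffOn ℝ m (fun p => ∫ s in a..b, c (p, s)) Ω := by
  induction m with
  | zero =>
    intro G _ _ c hc
    exact contDiffOn_zero.mpr (continuousOn_intervalIntegral_param (contDiffOn_zero.mp hc) a b)
  | succ m ih =>
    intro G _ _ c hc
    have hW : IsOpen (Ω ×ˢ (univ : Set ℝ)) := hΩ.prod isOpen_univ
    have h1 : ContDiffOn ℝ 1 c (Ω ×ˢ univ) := hc.of_le (by simp)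
    have hd := fun p (hp : p ∈ Ω) => hasFDerivAt_intervalIntegral_param hΩ h1 a b hp
    push_cast
    rw [contDiffOn_succ_iff_fderiv_of_isOpen hΩ]
    refine ⟨fun p hp => (hd p hp).differentiableAt.differentiableWithinAt, by simp, ?_⟩
    refine (ih (c := fun q => (fderiv ℝ c q).comp (ContinuousLinearMap.inl ℝ X ℝ)) ?_).congr
      fun p hp => (hd p hp).fderiv
    exact (hc.fderiv_of_isOpen hW (by simp)).clm_comp contDiffOn_const

theorem contDiffOn_intervalIntegral_param {X : Type} [NormedAddCommGroup X]
    [NormedSpace ℝ X] [ProperSpace X] {Ω : Set X} (hΩ : IsOpen Ω) (a b : ℝ)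
    {G : Type} [NormedAddCommGroup G] [NormedSpace ℝ G] {c : X × ℝ → G}
    (hc : ContDiffOn ℝ ∞ c (Ω ×ˢ univ)) :
    ContDiffOn ℝ ∞ (fun p => ∫ s in a..b, c (p, s)) Ω :=
  contDiffOn_infty.mpr fun m =>
    contDiffOn_nat_intervalIntegral_param hΩ a b m (contDiffOn_infty.mp hc m)

theorem contDiffOn_primitive_param {E : Type} [NormedAddCommGroup E]
    [NormedSpace ℝ E] [ProperSpace E] {D : Set E} (hD : IsOpen D)
    {G : Type} [NormedAddCommGroup G] [NormedSpace ℝ G] {c : ℝ × E → G}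
    (hc : ContDiffOn ℝ ∞ c (univ ×ˢ D)) :
    ContDiffOn ℝ ∞ (fun p : ℝ × E => ∫ s in (0 : ℝ)..p.1, c (s, p.2)) (univ ×ˢ D) := by
  -- The substitution `s = tσ` turns the moving endpoint into a parameter of an integral over `[0,
  -- 1]`.
  have h : ContDiffOn ℝ ∞ (fun q : (ℝ × E) × ℝ => c (q.1.1 * q.2, q.1.2))
      ((univ ×ˢ D) ×ˢ univ) :=
    hc.comp (by fun_prop) (fun q hq => ⟨mem_univ _, hq.1.2⟩)
  have h2 := contDiff_fst.contDiffOn.smul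
    (contDiffOn_intervalIntegral_param (isOpen_univ.prod hD) 0 1 h)
  refine h2.congr fun p _ => ?_
  have := intervalIntegral.smul_integral_comp_mul_left (fun s => c (s, p.2)) p.1 (a := 0) (b := 1)
  simpa using this.symm

/-! ### Faà di Bruno's formula in terms of Bell polynomials. -/

/-- Faà di Bruno's sum over set partitions, grouped by the number of blocks. For `j ≥ 1` that number
lies between `1` and `j`, so the groups exhaust the sum. -/
theorem sum_bellApply_eq_iteratedDeriv {E : Type*} [NormedAddCommGroup E] [NormedSpace ℝ E]
    {f : E → E} {γ : ℝ → E} (hγ : ContDiffAt ℝ ∞ γ 0) (hf : ContDiffAt ℝ ∞ f (γ 0)) {j : ℕ}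
    (hj : 1 ≤ j) :
    ∑ m ∈ Finset.Icc 1 j, bellApply j m (ftaylorSeries ℝ f (γ 0)) (fun q => iteratedDeriv q γ 0) =
      iteratedDeriv j (fun ε => f (γ ε)) 0 := by
  have hc : iteratedFDeriv ℝ j (fun ε => f (γ ε)) 0 = _ :=
    iteratedFDeriv_comp hf hγ (i := j) (by exact_mod_cast le_top)
  rw [iteratedDeriv_eq_iteratedFDeriv, hc]
  simp only [FormalMultilinearSeries.taylorComp, _root_.sum_apply,
    bellApply]
  rw [← Finset.sum_fiberwise_of_maps_to (g := fun c : OrderedFinpartition j => c.length)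
    (t := Finset.Icc 1 j)
    (fun c _ => Finset.mem_Icc.mpr ⟨c.length_pos hj, c.length_le⟩)]
  refine Finset.sum_congr rfl fun m _ => Finset.sum_congr rfl fun c _ => ?_
  rw [FormalMultilinearSeries.compAlongOrderedFinpartition_apply]
  rfl

theorem bellApply_congr {E : Type*} [NormedAddCommGroup E] [NormedSpace ℝ E] {j m : ℕ}
    (p : FormalMultilinearSeries ℝ E E) {y y' : ℕ → E} (h : ∀ q ∈ Finset.Icc 1 j, y q = y' q) :
    bellApply j m p y = bellApply j m p y' := by
  refine Finset.sum_congr rfl fun c _ => ?_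
  congr 1
  funext b
  exact h _ (Finset.mem_Icc.mpr ⟨c.partSize_pos b, c.partSize_le b⟩)

theorem sum_Icc_one_eq_sum_range {M : Type*} [AddCommMonoid M] (f : ℕ → M) (N : ℕ) :
    ∑ i ∈ Finset.Icc 1 N, f i = ∑ i ∈ Finset.range N, f (i + 1) := by
  rw [Finset.range_eq_Ico, Finset.sum_Ico_add' f 0 N 1]
  rfl

section

variable {n : ℕ}

/-! ### Near-identity maps as polynomials in `ε`. -/

theorem nearIdentity_zero (N : ℕ)
    (u : ℕ → ℝ → EuclideanSpace ℝ (Fin n) → EuclideanSpace ℝ (Fin n)) (t : ℝ)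
    (z : EuclideanSpace ℝ (Fin n)) : nearIdentity N u t z 0 = z := by
  rw [nearIdentity, Finset.sum_eq_zero, add_zero]
  intro i hi
  rw [zero_pow (by have := Finset.mem_Icc.mp hi; omega), zero_smul]

theorem nearIdentity_eq_sum_range (N : ℕ)
    (u : ℕ → ℝ → EuclideanSpace ℝ (Fin n) → EuclideanSpace ℝ (Fin n)) (t : ℝ)
    (z : EuclideanSpace ℝ (Fin n)) (ε : ℝ) :
    nearIdentity N u t z ε =
      ∑ i ∈ Finset.range (N + 1), ε ^ i • (if i = 0 then z else u i t z) := by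
  rw [Finset.sum_range_succ', nearIdentity, add_comm, sum_Icc_one_eq_sum_range]
  simp [add_comm]

theorem iteratedDeriv_nearIdentity (N : ℕ)
    (u : ℕ → ℝ → EuclideanSpace ℝ (Fin n) → EuclideanSpace ℝ (Fin n)) (t : ℝ)
    (z : EuclideanSpace ℝ (Fin n)) {q : ℕ} (hq : q ∈ Finset.Icc 1 N) :
    iteratedDeriv q (nearIdentity N u t z) 0 = (q ! : ℝ) • u q t z := by
  have hs : ContDiff ℝ ∞ (nearIdentity N u t z) := by unfold nearIdentity; fun_prop
  have h := hs.contDiffAt.sub_sum_iteratedDeriv_isLittleO N (f := nearIdentity N u t z)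
  rw [Finset.mem_Icc] at hq
  have h2 := eq_zero_of_sum_pow_smul_isLittleO (fun i => (if i = 0 then z else u i t z) -
    ((i ! : ℝ)⁻¹ • iteratedDeriv i (nearIdentity N u t z) 0)) N
    (h.congr_left fun ε => by
      rw [nearIdentity_eq_sum_range]
      simp only [smul_sub, Finset.sum_sub_distrib]) q hq.2
  rw [if_neg (by omega), sub_eq_zero] at h2
  rw [h2, smul_smul, mul_inv_cancel₀ (by exact_mod_cast Nat.factorial_ne_zero q), one_smul]

theorem contDiffOn_nearIdentity {N : ℕ}
    {u : ℕ → ℝ → EuclideanSpace ℝ (Fin n) → EuclideanSpace ℝ (Fin n)}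
    {D : Set (EuclideanSpace ℝ (Fin n))}
    (hu : ∀ i ∈ Finset.Icc 1 N,
      ContDiffOn ℝ ∞ (fun p : ℝ × EuclideanSpace ℝ (Fin n) => u i p.1 p.2) (univ ×ˢ D)) :
    ContDiffOn ℝ ∞ (fun q : (ℝ × EuclideanSpace ℝ (Fin n)) × ℝ =>
      nearIdentity N u q.1.1 q.1.2 q.2) ((univ ×ˢ D) ×ˢ univ) := by
  unfold nearIdentity
  refine ContDiffOn.add (by fun_prop) (ContDiffOn.sum fun i hi =>
    ContDiffOn.smul (contDiff_snd.pow i).contDiffOn ?_)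
  exact (hu i hi).comp contDiff_fst.contDiffOn (fun q hq => hq.1)

/-- The set of those `(t, z, ε)` for which `z` and its image under the near-identity map
belong to `D`. -/
def nearIdentityDomain (N : ℕ)
    (u : ℕ → ℝ → EuclideanSpace ℝ (Fin n) → EuclideanSpace ℝ (Fin n))
    (D : Set (EuclideanSpace ℝ (Fin n))) : Set ((ℝ × EuclideanSpace ℝ (Fin n)) × ℝ) :=
  ((univ ×ˢ D) ×ˢ univ) ∩ (fun q => nearIdentity N u q.1.1 q.1.2 q.2) ⁻¹' D

theorem isOpen_nearIdentityDomain {N : ℕ}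
    {u : ℕ → ℝ → EuclideanSpace ℝ (Fin n) → EuclideanSpace ℝ (Fin n)}
    {D : Set (EuclideanSpace ℝ (Fin n))} (hD : IsOpen D)
    (hu : ∀ i ∈ Finset.Icc 1 N,
      ContDiffOn ℝ ∞ (fun p : ℝ × EuclideanSpace ℝ (Fin n) => u i p.1 p.2) (univ ×ˢ D)) :
    IsOpen (nearIdentityDomain N u D) :=
  (contDiffOn_nearIdentity hu).continuousOn.isOpen_inter_preimage
    ((isOpen_univ.prod hD).prod isOpen_univ) hD

theorem mem_nearIdentityDomain_zero {N : ℕ}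
    {u : ℕ → ℝ → EuclideanSpace ℝ (Fin n) → EuclideanSpace ℝ (Fin n)}
    {D : Set (EuclideanSpace ℝ (Fin n))} {p : ℝ × EuclideanSpace ℝ (Fin n)} (hp : p.2 ∈ D) :
    (p, (0 : ℝ)) ∈ nearIdentityDomain N u D :=
  ⟨⟨⟨mem_univ _, hp⟩, mem_univ _⟩, by simpa [nearIdentity_zero] using hp⟩

theorem contDiffOn_comp_nearIdentity {N : ℕ}
    {u : ℕ → ℝ → EuclideanSpace ℝ (Fin n) → EuclideanSpace ℝ (Fin n)}
    {D : Set (EuclideanSpace ℝ (Fin n))}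
    (hu : ∀ i ∈ Finset.Icc 1 N,
      ContDiffOn ℝ ∞ (fun p : ℝ × EuclideanSpace ℝ (Fin n) => u i p.1 p.2) (univ ×ˢ D))
    {f : ℝ → EuclideanSpace ℝ (Fin n) → EuclideanSpace ℝ (Fin n)}
    (hf : ContDiffOn ℝ ∞ (fun p : ℝ × EuclideanSpace ℝ (Fin n) => f p.1 p.2) (univ ×ˢ D)) :
    ContDiffOn ℝ ∞ (fun q : (ℝ × EuclideanSpace ℝ (Fin n)) × ℝ =>
      f q.1.1 (nearIdentity N u q.1.1 q.1.2 q.2)) (nearIdentityDomain N u D) :=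
  hf.comp (ContDiffOn.prodMk (by fun_prop)
    ((contDiffOn_nearIdentity hu).mono inter_subset_left)) (fun q hq => ⟨mem_univ _, hq.2⟩)

/-! ### The Melnikov expansion as an approximate solution. -/

/-- The normalized functions `y_i / i!`. -/
noncomputable def melnikovCoeff
    (F : ℕ → ℝ → EuclideanSpace ℝ (Fin n) → EuclideanSpace ℝ (Fin n)) (i : ℕ) (t : ℝ)
    (z : EuclideanSpace ℝ (Fin n)) : EuclideanSpace ℝ (Fin n) :=
  (1 / (i ! : ℝ)) • melnikovY F i t z

/-- The solution of the perturbed equation with initial value `z` at `t = 0`, truncated at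
order `N` in `ε`. -/
noncomputable def melnikovExpansion (F : ℕ → ℝ → EuclideanSpace ℝ (Fin n) → EuclideanSpace ℝ (Fin n)) (N : ℕ) :
    ℝ → EuclideanSpace ℝ (Fin n) → ℝ → EuclideanSpace ℝ (Fin n) :=
  nearIdentity N (melnikovCoeff F)

/-- The integrand of `melnikovY`. -/
noncomputable def melnikovIntegrand (F : ℕ → ℝ → EuclideanSpace ℝ (Fin n) → EuclideanSpace ℝ (Fin n)) (i : ℕ)
    (s : ℝ) (z : EuclideanSpace ℝ (Fin n)) : EuclideanSpace ℝ (Fin n) :=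
  (i ! : ℝ) • F i s z +
    ∑ j ∈ Finset.Icc 1 (i - 1), ((i ! : ℝ) / (j ! : ℝ)) • ∑ m ∈ Finset.Icc 1 j,
      bellApply j m (ftaylorSeries ℝ (F (i - j) s) z) (fun q => melnikovY F q s z)

/-- The recursion guard is harmless: a block of a partition of `j ≤ i - 1` elements has size less
than `i`. -/
theorem melnikovY_eq_integral
    (F : ℕ → ℝ → EuclideanSpace ℝ (Fin n) → EuclideanSpace ℝ (Fin n)) (i : ℕ) (t : ℝ)
    (z : EuclideanSpace ℝ (Fin n)) :
    melnikovY F i t z = ∫ s in (0 : ℝ)..t, melnikovIntegrand F i s z := by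
  rw [melnikovY]
  refine intervalIntegral.integral_congr fun s _ => ?_
  simp only [melnikovIntegrand, Finset.smul_sum]
  congr 1
  refine Finset.sum_congr rfl fun j hj => Finset.sum_congr rfl fun m _ => ?_
  congr 1
  refine bellApply_congr _ fun q hq => ?_
  rw [Finset.mem_Icc] at hj hq
  rw [dif_pos (by omega)]

/-- Since `y_q / q!` is the coefficient of `ε^q`, the vector `y_q` is the `q`-th `ε`-derivative of
the expansion at `0`, and Faà di Bruno applies. Any truncation order `N ≥ j` gives the same value.
-/
theorem sum_bellApply_melnikovY {D : Set (EuclideanSpace ℝ (Fin n))} (hD : IsOpen D)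
    {f : EuclideanSpace ℝ (Fin n) → EuclideanSpace ℝ (Fin n)} (hf : ContDiffOn ℝ ∞ f D)
    (F : ℕ → ℝ → EuclideanSpace ℝ (Fin n) → EuclideanSpace ℝ (Fin n)) {N j : ℕ}
    (hj : j ∈ Finset.Icc 1 N) (s : ℝ) {z : EuclideanSpace ℝ (Fin n)} (hz : z ∈ D) :
    ∑ m ∈ Finset.Icc 1 j, bellApply j m (ftaylorSeries ℝ f z) (fun q => melnikovY F q s z) =
      iteratedDeriv j (fun ε => f (melnikovExpansion F N s z ε)) 0 := by
  have h0 : melnikovExpansion F N s z 0 = z := nearIdentity_zero _ _ _ _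
  have hs : ContDiff ℝ ∞ (melnikovExpansion F N s z) := by
    unfold melnikovExpansion nearIdentity; fun_prop
  rw [Finset.mem_Icc] at hj
  rw [← sum_bellApply_eq_iteratedDeriv hs.contDiffAt
    (by rw [h0]; exact hf.contDiffAt (hD.mem_nhds hz)) hj.1, h0]
  refine Finset.sum_congr rfl fun m _ => bellApply_congr _ fun q hq => ?_
  rw [Finset.mem_Icc] at hq
  rw [melnikovExpansion, iteratedDeriv_nearIdentity _ _ _ _ (Finset.mem_Icc.mpr ⟨hq.1, by omega⟩),
    melnikovCoeff, smul_smul, mul_one_div_cancel (by exact_mod_cast Nat.factorial_ne_zero q), one_smul]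

theorem contDiffOn_slice {D : Set (EuclideanSpace ℝ (Fin n))}
    {f : ℝ → EuclideanSpace ℝ (Fin n) → EuclideanSpace ℝ (Fin n)}
    (hf : ContDiffOn ℝ ∞ (fun p : ℝ × EuclideanSpace ℝ (Fin n) => f p.1 p.2) (univ ×ˢ D)) (t : ℝ) :
    ContDiffOn ℝ ∞ (f t) D :=
  hf.comp (f := fun z => (t, z)) (by fun_prop) (fun _ hz => ⟨mem_univ _, hz⟩)

section
variable {k : ℕ} {D : Set (EuclideanSpace ℝ (Fin n))} (hD : IsOpen D)
  {F : ℕ → ℝ → EuclideanSpace ℝ (Fin n) → EuclideanSpace ℝ (Fin n)}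
  (hF : ∀ i ∈ Finset.Icc 1 k,
    ContDiffOn ℝ ∞ (fun p : ℝ × EuclideanSpace ℝ (Fin n) => F i p.1 p.2) (univ ×ˢ D))
include hD hF

/-- Smoothness of the Bell sums comes for free from their reading as `ε`-derivatives at `0` of a
function jointly smooth in `(t, z, ε)`. The truncation at order `i - 1` involves only the lower
`y_q`, as the recursion requires. -/
theorem contDiffOn_melnikovIntegrand {i : ℕ} (hi : i ∈ Finset.Icc 1 k)
    (hY : ∀ q ∈ Finset.Icc 1 (i - 1), ContDiffOn ℝ ∞
      (fun p : ℝ × EuclideanSpace ℝ (Fin n) => melnikovY F q p.1 p.2) (univ ×ˢ D)) :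
    ContDiffOn ℝ ∞ (fun p : ℝ × EuclideanSpace ℝ (Fin n) => melnikovIntegrand F i p.1 p.2)
      (univ ×ˢ D) := by
  rw [Finset.mem_Icc] at hi
  have hu : ∀ q ∈ Finset.Icc 1 (i - 1), ContDiffOn ℝ ∞ (fun p : ℝ × EuclideanSpace ℝ (Fin n) =>
      melnikovCoeff F q p.1 p.2) (univ ×ˢ D) := fun q hq =>
    (hY q hq).const_smul _
  refine ContDiffOn.add ((hF i (Finset.mem_Icc.mpr hi)).const_smul _)
    (ContDiffOn.sum fun j hj => ContDiffOn.const_smul _ ?_)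
  have hij : i - j ∈ Finset.Icc 1 k := by rw [Finset.mem_Icc] at hj ⊢; omega
  have h1 := (contDiffOn_comp_nearIdentity hu (hF _ hij)).iteratedDeriv_snd
    (isOpen_nearIdentityDomain hD hu) j
  refine (h1.comp (f := fun p => (p, (0 : ℝ))) (by fun_prop)
    (fun p hp => mem_nearIdentityDomain_zero hp.2)).congr fun p hp => ?_
  exact sum_bellApply_melnikovY hD (contDiffOn_slice (hF _ hij) p.1) F hj p.1 hp.2

theorem contDiffOn_melnikovY (i : ℕ) : i ∈ Finset.Icc 1 k →
    ContDiffOn ℝ ∞ (fun p : ℝ × EuclideanSpace ℝ (Fin n) => melnikovY F i p.1 p.2)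
      (univ ×ˢ D) := by
  induction i using Nat.strong_induction_on with
  | _ i ih =>
    intro hi
    have h := contDiffOn_melnikovIntegrand hD hF hi fun q hq =>
      ih q (by rw [Finset.mem_Icc] at *; omega) (by rw [Finset.mem_Icc] at *; omega)
    refine (contDiffOn_primitive_param hD h).congr fun p _ => melnikovY_eq_integral F i p.1 p.2

theorem hasDerivAt_melnikovY {i : ℕ} (hi : i ∈ Finset.Icc 1 k) (t : ℝ)
    {z : EuclideanSpace ℝ (Fin n)} (hz : z ∈ D) :
    HasDerivAt (fun s => melnikovY F i s z) (melnikovIntegrand F i t z) t := by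
  have h := contDiffOn_melnikovIntegrand hD hF hi fun q hq =>
      contDiffOn_melnikovY hD hF q (by rw [Finset.mem_Icc] at *; omega)
  have hc : Continuous fun s => melnikovIntegrand F i s z :=
    h.continuousOn.comp_continuous (f := fun s => (s, z)) (by fun_prop)
      (fun s => ⟨mem_univ _, hz⟩)
  simp only [melnikovY_eq_integral]
  exact (hc.integral_hasStrictDerivAt 0 t).hasDerivAt

theorem contDiffOn_melnikovExpansion_coeff {N : ℕ} (hN : N ≤ k) : ∀ i ∈ Finset.Icc 1 N,
    ContDiffOn ℝ ∞ (fun p : ℝ × EuclideanSpace ℝ (Fin n) =>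
      melnikovCoeff F i p.1 p.2) (univ ×ˢ D) := fun i hi =>
  (contDiffOn_melnikovY hD hF i (Finset.Icc_subset_Icc_right hN hi)).const_smul _

/-- The integrand of `y_i / i!` is the sum of the `ε^j` coefficients of `F_{i-j}` along the
expansion, so both sides of the equation have the same coefficients up to order `N`. Expanding `F_i`
to order `N - i` suffices because of its factor `ε^i`. -/
theorem melnikovExpansion_residual_isLittleO {N : ℕ} (hN : N ≤ k) (t : ℝ)
    {z : EuclideanSpace ℝ (Fin n)} (hz : z ∈ D) :
    (fun ε => deriv (fun s => melnikovExpansion F N s z ε) t -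
      ∑ i ∈ Finset.Icc 1 N, ε ^ i • F i t (melnikovExpansion F N t z ε)) =o[𝓝[>] 0]
      fun ε => ε ^ N := by
  set J : ℕ → ℕ → EuclideanSpace ℝ (Fin n) := fun i j =>
    (j ! : ℝ)⁻¹ • iteratedDeriv j (fun ε => F i t (melnikovExpansion F N t z ε)) 0 with hJ
  have hmem : ∀ i ∈ Finset.Icc 1 N, i ∈ Finset.Icc 1 k := Finset.Icc_subset_Icc_right hN
  have hcoef : ∀ i ∈ Finset.Icc 1 N, (1 / (i ! : ℝ)) • melnikovIntegrand F i t z =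
      ∑ j ∈ Finset.range i, J (i - j) j := by
    intro i hi
    rw [Finset.mem_Icc] at hi
    have hfac : (i ! : ℝ) ≠ 0 := by exact_mod_cast Nat.factorial_ne_zero i
    obtain ⟨i, rfl⟩ : ∃ a, i = a + 1 := ⟨i - 1, by omega⟩
    rw [melnikovIntegrand, Finset.sum_range_succ', smul_add, smul_smul, one_div_mul_cancel hfac,
      one_smul, add_comm, Finset.smul_sum, sum_Icc_one_eq_sum_range]
    congr 1
    · refine Finset.sum_congr rfl fun j hj => ?_
      rw [Finset.mem_range] at hj
      rw [smul_smul, sum_bellApply_melnikovY hD (contDiffOn_slice (hF _ ?_) t) F (N := N) ?_ t hz]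
      · rw [hJ]
        congr 1
        field_simp
      · rw [Finset.mem_Icc]; omega
      · rw [Finset.mem_Icc]; omega
    · simp [hJ, melnikovExpansion, nearIdentity_zero]
  have hderiv : ∀ ε, deriv (fun s => melnikovExpansion F N s z ε) t =
      ∑ i ∈ Finset.Icc 1 N, ε ^ i • ∑ j ∈ Finset.range i, J (i - j) j := by
    intro ε
    have : HasDerivAt (fun s => melnikovExpansion F N s z ε)
        (∑ i ∈ Finset.Icc 1 N, ε ^ i • ((1 / (i ! : ℝ)) • melnikovIntegrand F i t z)) t := by
      unfold melnikovExpansion nearIdentity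
      refine HasDerivAt.const_add _ (HasDerivAt.fun_sum fun i hi => ?_)
      exact ((hasDerivAt_melnikovY hD hF (hmem i hi) t hz).fun_const_smul _).fun_const_smul _
    rw [this.deriv]
    exact Finset.sum_congr rfl fun i hi => by rw [hcoef i hi]
  -- Cauchy product: the left side groups terms by total order, the right side by the index of `F`.
  have hre : ∀ ε : ℝ, ∑ i ∈ Finset.Icc 1 N, ε ^ i • ∑ j ∈ Finset.range i, J (i - j) j =
      ∑ i ∈ Finset.Icc 1 N, ε ^ i • ∑ j ∈ Finset.range (N - i + 1), ε ^ j • J i j := by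
    intro ε
    simp only [Finset.smul_sum, smul_smul, ← pow_add]
    rw [Finset.sum_sigma', Finset.sum_sigma']
    refine Finset.sum_bij' (fun x _ => ⟨x.1 - x.2, x.2⟩) (fun x _ => ⟨x.1 + x.2, x.2⟩) ?_ ?_ ?_ ?_ ?_
    · rintro ⟨i, j⟩ h; simp at h ⊢; omega
    · rintro ⟨i, j⟩ h; simp at h ⊢; omega
    · rintro ⟨i, j⟩ h; simp at h ⊢; omega
    · rintro ⟨i, j⟩ h; simp at h ⊢
    · rintro ⟨i, j⟩ h
      simp at h ⊢
      rw [Nat.sub_add_cancel (by omega)]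
  have hsm : ∀ i ∈ Finset.Icc 1 N,
      ContDiffAt ℝ ∞ (fun ε => F i t (melnikovExpansion F N t z ε)) 0 := by
    intro i hi
    have hu := contDiffOn_melnikovExpansion_coeff hD hF hN
    exact ((contDiffOn_comp_nearIdentity hu (hF i (hmem i hi))).contDiffAt
      ((isOpen_nearIdentityDomain hD hu).mem_nhds (mem_nearIdentityDomain_zero
        (p := (t, z)) hz))).comp (0 : ℝ) (f := fun ε => ((t, z), ε)) (by fun_prop)
  have hsum : (fun ε : ℝ => ∑ i ∈ Finset.Icc 1 N, ε ^ i • (F i t (melnikovExpansion F N t z ε) -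
      ∑ j ∈ Finset.range (N - i + 1), ε ^ j • J i j)) =o[𝓝[>] 0] fun ε => ε ^ N := by
    refine IsLittleO.fun_sum fun i hi => ?_
    refine ((isBigO_refl (fun ε : ℝ => ε ^ i) _).smul_isLittleO
      ((hsm i hi).sub_sum_iteratedDeriv_isLittleO (N - i))).congr_right fun ε => ?_
    rw [Finset.mem_Icc] at hi
    rw [smul_eq_mul, ← pow_add]
    congr 1; omega
  refine hsum.neg_left.congr_left fun ε => ?_
  rw [hderiv, hre]
  simp only [smul_sub, Finset.sum_sub_distrib]
  abel
end

/-! ### Comparison of coefficients and derivatives of near-identity maps. -/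

theorem nearIdentity_coeff_eq {k N : ℕ}
    {u v : ℕ → ℝ → EuclideanSpace ℝ (Fin n) → EuclideanSpace ℝ (Fin n)} {t : ℝ}
    {z : EuclideanSpace ℝ (Fin n)}
    (h : (fun ε => nearIdentity k u t z ε - nearIdentity k v t z ε) =o[𝓝[>] 0] fun ε => ε ^ N)
    {i : ℕ} (hi : i ∈ Finset.Icc 1 k) (hiN : i ≤ N) : u i t z = v i t z := by
  -- The difference of the two maps is again of near-identity form, with base point `0`.
  have hs : ContDiff ℝ ∞ (nearIdentity k (fun i _ _ => u i t z - v i t z) t 0) := by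
    unfold nearIdentity; fun_prop
  have h1 : nearIdentity k (fun i _ _ => u i t z - v i t z) t 0 =o[𝓝[>] 0] fun ε => ε ^ N := by
    refine h.congr_left fun ε => ?_
    simp only [nearIdentity, smul_sub, Finset.sum_sub_distrib]
    abel
  have h2 := iteratedDeriv_eq_zero_of_isLittleO hs.contDiffAt h1 i hiN
  rw [iteratedDeriv_nearIdentity k _ t 0 hi] at h2
  exact sub_eq_zero.mp ((smul_eq_zero.mp h2).resolve_left
    (by exact_mod_cast Nat.factorial_ne_zero i))

section
variable {k : ℕ} {D : Set (EuclideanSpace ℝ (Fin n))} (hD : IsOpen D)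
  {u : ℕ → ℝ → EuclideanSpace ℝ (Fin n) → EuclideanSpace ℝ (Fin n)}
  (hu : ∀ i ∈ Finset.Icc 1 k,
    ContDiffOn ℝ ∞ (fun p : ℝ × EuclideanSpace ℝ (Fin n) => u i p.1 p.2) (univ ×ˢ D))
include hD hu

theorem nearIdentity_mem_ball (T : ℝ) {K : Set (EuclideanSpace ℝ (Fin n))} (hKD : K ⊆ D)
    (hK : IsCompact K) {ρ : ℝ} (hρ : 0 < ρ) :
    ∃ δ > 0, ∀ t ∈ Icc 0 T, ∀ z ∈ K, ∀ ε ∈ Icc 0 δ,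
      nearIdentity k u t z ε ∈ Metric.ball z ρ := by
  have hW : IsOpen (((univ ×ˢ D) ×ˢ univ) ∩
      (fun q : (ℝ × EuclideanSpace ℝ (Fin n)) × ℝ => nearIdentity k u q.1.1 q.1.2 q.2 - q.1.2) ⁻¹'
        Metric.ball 0 ρ) :=
    ((contDiffOn_nearIdentity hu).continuousOn.sub (by fun_prop)).isOpen_inter_preimage
      ((isOpen_univ.prod hD).prod isOpen_univ) Metric.isOpen_ball
  obtain ⟨δ, hδ, h⟩ := exists_Icc_subset_of_isCompact
    ((isCompact_Icc (a := (0 : ℝ)) (b := T)).prod hK) hW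
    (fun p hp => ⟨⟨⟨mem_univ _, hKD hp.2⟩, mem_univ _⟩, by simpa [nearIdentity_zero] using hρ⟩)
  refine ⟨δ, hδ, fun t ht z hz ε hε => ?_⟩
  simpa [dist_eq_norm] using (h (t, z) ⟨ht, hz⟩ ε hε).2

theorem hasFDerivAt_nearIdentity (t : ℝ) {z : EuclideanSpace ℝ (Fin n)} (hz : z ∈ D) (ε : ℝ) :
    HasFDerivAt (fun p : ℝ × EuclideanSpace ℝ (Fin n) => nearIdentity k u p.1 p.2 ε)
      ((fderiv ℝ (fun q : (ℝ × EuclideanSpace ℝ (Fin n)) × ℝ =>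
        nearIdentity k u q.1.1 q.1.2 q.2) ((t, z), ε)).comp (ContinuousLinearMap.inl ℝ _ ℝ))
      (t, z) := by
  have h := ((contDiffOn_nearIdentity hu).contDiffAt
    (((isOpen_univ.prod hD).prod isOpen_univ).mem_nhds
      (show ((t, z), ε) ∈ (univ ×ˢ D) ×ˢ univ from ⟨⟨mem_univ _, hz⟩, mem_univ _⟩)))
  exact (h.differentiableAt (by simp)).hasFDerivAt.comp (t, z)
    (f := fun p => (p, ε)) (hasFDerivAt_prodMk_left _ _)

theorem hasDerivAt_nearIdentity_comp {t : ℝ} {γ : ℝ → EuclideanSpace ℝ (Fin n)}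
    {γ' : EuclideanSpace ℝ (Fin n)} (hz : γ t ∈ D) (hγ : HasDerivAt γ γ' t) (ε : ℝ) :
    HasDerivAt (fun s => nearIdentity k u s (γ s) ε)
      (deriv (fun s => nearIdentity k u s (γ t) ε) t +
        fderiv ℝ (fun w => nearIdentity k u t w ε) (γ t) γ') t := by
  have h := hasFDerivAt_nearIdentity hD hu t hz ε
  have h1 := (h.comp_hasDerivAt t ((hasDerivAt_id t).prodMk (hasDerivAt_const t (γ t)))).deriv
  have h2 := (h.comp (γ t) (hasFDerivAt_prodMk_right t (γ t))).fderiv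
  have h3 := h.comp_hasDerivAt t ((hasDerivAt_id t).prodMk hγ)
  simp only [Function.comp_def, id] at h1 h2 h3
  rw [h1, h2]
  refine h3.congr_deriv ?_
  rw [ContinuousLinearMap.comp_apply _ (ContinuousLinearMap.inr ℝ ℝ _), ← map_add]
  simp

theorem contDiffOn_fderiv_nearIdentity :
    ContDiffOn ℝ ∞ (fun q : (ℝ × EuclideanSpace ℝ (Fin n)) × ℝ =>
      fderiv ℝ (fun w => nearIdentity k u q.1.1 w q.2) q.1.2) ((univ ×ˢ D) ×ˢ univ) := by
  have h1 := ((contDiffOn_nearIdentity hu).fderiv_of_isOpen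
    ((isOpen_univ.prod hD).prod isOpen_univ) (m := ∞) (by simp)).clm_comp
    (contDiffOn_const (c := (ContinuousLinearMap.inl ℝ (ℝ × EuclideanSpace ℝ (Fin n)) ℝ).comp
      (ContinuousLinearMap.inr ℝ ℝ (EuclideanSpace ℝ (Fin n)))))
  refine h1.congr fun q hq => ?_
  exact ((hasFDerivAt_nearIdentity hD hu q.1.1 hq.1.2 q.2).comp q.1.2
    (hasFDerivAt_prodMk_right q.1.1 q.1.2)).fderiv

theorem contDiffOn_deriv_nearIdentity :
    ContDiffOn ℝ ∞ (fun q : (ℝ × EuclideanSpace ℝ (Fin n)) × ℝ =>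
      deriv (fun s => nearIdentity k u s q.1.2 q.2) q.1.1) ((univ ×ˢ D) ×ˢ univ) := by
  have h1 := ((contDiffOn_nearIdentity hu).fderiv_of_isOpen
    ((isOpen_univ.prod hD).prod isOpen_univ) (m := ∞) (by simp)).clm_apply
    (contDiffOn_const (c := (((1 : ℝ), (0 : EuclideanSpace ℝ (Fin n))), (0 : ℝ))))
  refine h1.congr fun q hq => ?_
  have h := hasFDerivAt_nearIdentity hD hu q.1.1 hq.1.2 q.2
  exact (h.comp_hasDerivAt q.1.1
    ((hasDerivAt_id q.1.1).prodMk (hasDerivAt_const q.1.1 q.1.2))).deriv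

end

/-! ### Defects of approximate solutions and the Grönwall comparison. -/

/-- The defect of `x = U(t,z,ε)` as a transformation of `x' = ∑ ε^i F_i(t,x)` into
`z' = ∑ ε^i g_i(z)`. -/
noncomputable def averagingResidual (k : ℕ)
    (F : ℕ → ℝ → EuclideanSpace ℝ (Fin n) → EuclideanSpace ℝ (Fin n))
    (u : ℕ → ℝ → EuclideanSpace ℝ (Fin n) → EuclideanSpace ℝ (Fin n))
    (g : ℕ → EuclideanSpace ℝ (Fin n) → EuclideanSpace ℝ (Fin n)) (t : ℝ)
    (z : EuclideanSpace ℝ (Fin n)) (ε : ℝ) : EuclideanSpace ℝ (Fin n) :=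
  deriv (fun s => nearIdentity k u s z ε) t +
      fderiv ℝ (fun w => nearIdentity k u t w ε) z (∑ i ∈ Finset.Icc 1 k, ε ^ i • g i z) -
    ∑ i ∈ Finset.Icc 1 k, ε ^ i • F i t (nearIdentity k u t z ε)

theorem exists_uniform_lipschitz {X E G : Type*} [NormedAddCommGroup X] [NormedSpace ℝ X]
    [NormedAddCommGroup E] [NormedSpace ℝ E] [NormedAddCommGroup G] [NormedSpace ℝ G]
    {f : X × E → G} {D : Set E} (hD : IsOpen D) (hf : ContDiffOn ℝ ∞ f (univ ×ˢ D))
    {K : Set X} (hK : IsCompact K) {B : Set E} (hB : IsCompact B) (hBc : Convex ℝ B)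
    (hBD : B ⊆ D) :
    ∃ L, 0 ≤ L ∧ ∀ p ∈ K, ∀ x ∈ B, ∀ y ∈ B, ‖f (p, x) - f (p, y)‖ ≤ L * ‖x - y‖ := by
  have hW : IsOpen ((univ : Set X) ×ˢ D) := isOpen_univ.prod hD
  have hd : ContDiffOn ℝ ∞ (fun q => (fderiv ℝ f q).comp (ContinuousLinearMap.inr ℝ X E))
      (univ ×ˢ D) := (hf.fderiv_of_isOpen hW (by simp)).clm_comp contDiffOn_const
  obtain ⟨L, hL⟩ := (hK.prod hB).exists_bound_of_continuousOn
    (hd.continuousOn.mono (prod_mono (subset_univ _) hBD))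
  refine ⟨max L 0, le_max_right _ _, fun p hp x hx y hy => ?_⟩
  refine hBc.norm_image_sub_le_of_norm_hasFDerivWithin_le (f := fun x => f (p, x))
    (f' := fun x => (fderiv ℝ f (p, x)).comp (ContinuousLinearMap.inr ℝ X E))
    (fun w hw => HasFDerivAt.hasFDerivWithinAt ?_)
    (fun w hw => (hL (p, w) ⟨hp, hw⟩).trans (le_max_left _ _)) hy hx
  exact ((hf.contDiffAt (hW.mem_nhds ⟨mem_univ p, hBD hw⟩)).differentiableAt
    (by simp)).hasFDerivAt.comp w (hasFDerivAt_prodMk_right p w)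

section
variable {k : ℕ} {D : Set (EuclideanSpace ℝ (Fin n))} (hD : IsOpen D)
  {F : ℕ → ℝ → EuclideanSpace ℝ (Fin n) → EuclideanSpace ℝ (Fin n)}
  (hF : ∀ i ∈ Finset.Icc 1 k,
    ContDiffOn ℝ ∞ (fun p : ℝ × EuclideanSpace ℝ (Fin n) => F i p.1 p.2) (univ ×ˢ D))
include hD hF

theorem contDiffOn_residual
    {u : ℕ → ℝ → EuclideanSpace ℝ (Fin n) → EuclideanSpace ℝ (Fin n)}
    (hu : ∀ i ∈ Finset.Icc 1 k,
      ContDiffOn ℝ ∞ (fun p : ℝ × EuclideanSpace ℝ (Fin n) => u i p.1 p.2) (univ ×ˢ D))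
    {g : ℕ → EuclideanSpace ℝ (Fin n) → EuclideanSpace ℝ (Fin n)}
    (hg : ∀ i ∈ Finset.Icc 1 k, ContDiffOn ℝ ∞ (g i) D) :
    ContDiffOn ℝ ∞ (fun q : (ℝ × EuclideanSpace ℝ (Fin n)) × ℝ =>
      averagingResidual k F u g q.1.1 q.1.2 q.2) (nearIdentityDomain k u D) :=
  (((contDiffOn_deriv_nearIdentity hD hu).mono inter_subset_left).add
    (((contDiffOn_fderiv_nearIdentity hD hu).mono inter_subset_left).clm_apply
      (ContDiffOn.sum fun i hi => (contDiff_snd.pow i).contDiffOn.smul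
        ((hg i hi).comp (by fun_prop) fun q hq => hq.1.1.2)))).sub
      (ContDiffOn.sum fun i hi => (contDiff_snd.pow i).contDiffOn.smul
        (contDiffOn_comp_nearIdentity hu (hF i hi)))

/-- A pointwise estimate of the residual holds uniformly on compact sets. -/
theorem residual_uniform_bound
    {u : ℕ → ℝ → EuclideanSpace ℝ (Fin n) → EuclideanSpace ℝ (Fin n)}
    (hu : ∀ i ∈ Finset.Icc 1 k,
      ContDiffOn ℝ ∞ (fun p : ℝ × EuclideanSpace ℝ (Fin n) => u i p.1 p.2) (univ ×ˢ D))
    {g : ℕ → EuclideanSpace ℝ (Fin n) → EuclideanSpace ℝ (Fin n)}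
    (hg : ∀ i ∈ Finset.Icc 1 k, ContDiffOn ℝ ∞ (g i) D) {N : ℕ}
    (h : ∀ t, ∀ z ∈ D, (fun ε => averagingResidual k F u g t z ε) =o[𝓝[>] 0] fun ε : ℝ => ε ^ N)
    (T : ℝ) {K : Set (EuclideanSpace ℝ (Fin n))} (hKD : K ⊆ D) (hK : IsCompact K) :
    ∃ δ > 0, ∃ C, ∀ t ∈ Icc 0 T, ∀ z ∈ K, ∀ ε ∈ Icc 0 δ,
      ‖averagingResidual k F u g t z ε‖ ≤ C * ε ^ (N + 1) := by
  obtain ⟨δ, hδ, C, hC⟩ := exists_uniform_bound_of_isLittleO (isOpen_nearIdentityDomain hD hu)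
    (contDiffOn_residual hD hF hu hg) ((isCompact_Icc (a := (0 : ℝ)) (b := T)).prod hK)
    (fun p hp => mem_nearIdentityDomain_zero (hKD hp.2)) (fun p hp => h p.1 p.2 (hKD hp.2))
  exact ⟨δ, hδ, C, fun t ht z hz ε hε => (hC (t, z) ⟨ht, hz⟩ ε hε).2⟩

theorem melnikovExpansion_residual_bound (T : ℝ) {z : EuclideanSpace ℝ (Fin n)} (hz : z ∈ D) :
    ∃ δ > 0, ∃ C, ∀ t ∈ Icc 0 T, ∀ ε ∈ Icc 0 δ,
      HasDerivAt (fun s => melnikovExpansion F k s z ε)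
        (deriv (fun s => melnikovExpansion F k s z ε) t) t ∧
      ‖deriv (fun s => melnikovExpansion F k s z ε) t -
        ∑ i ∈ Finset.Icc 1 k, ε ^ i • F i t (melnikovExpansion F k t z ε)‖ ≤ C * ε ^ (k + 1) := by
  have hu := contDiffOn_melnikovExpansion_coeff hD hF le_rfl
  -- With `g = 0` and `z` frozen, the averaging residual is exactly the defect of `t ↦ U(t,z,ε)` in
  -- the differential equation.
  obtain ⟨δ, hδ, C, h⟩ := residual_uniform_bound hD hF hu (g := fun _ _ => 0)
    (fun _ _ => contDiffOn_const) (N := k) (fun t w hw => by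
      simpa [averagingResidual, melnikovExpansion] using melnikovExpansion_residual_isLittleO hD hF le_rfl t hw)
    T (singleton_subset_iff.mpr hz) isCompact_singleton
  refine ⟨δ, hδ, C, fun t ht ε hε => ⟨?_, by
    simpa [averagingResidual, melnikovExpansion] using h t ht z rfl ε hε⟩⟩
  exact (hasDerivAt_nearIdentity_comp hD hu (γ := fun _ => z) hz
    (hasDerivAt_const t z) ε).differentiableAt.hasDerivAt

/-- An approximate solution of the perturbed equation agrees with the Melnikov expansion. -/
theorem sub_melnikovExpansion_isLittleO {T : ℝ} (hT : 0 < T) {z : EuclideanSpace ℝ (Fin n)}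
    (hz : z ∈ D) {N : ℕ} (hN : N ≤ k) {x x' : ℝ → ℝ → EuclideanSpace ℝ (Fin n)} {δ C : ℝ}
    (hδ : 0 < δ) (hx0 : ∀ ε ∈ Ioc 0 δ, x 0 ε = z)
    (hxd : ∀ t ∈ Icc 0 T, ∀ ε ∈ Ioc 0 δ, HasDerivAt (fun s => x s ε) (x' t ε) t)
    (hball : ∀ ρ > 0, ∃ δ' > 0, ∀ t ∈ Icc 0 T, ∀ ε ∈ Ioc 0 δ', x t ε ∈ Metric.ball z ρ)
    (hres : ∀ t ∈ Icc 0 T, ∀ ε ∈ Ioc 0 δ,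
      ‖x' t ε - ∑ i ∈ Finset.Icc 1 k, ε ^ i • F i t (x t ε)‖ ≤ C * ε ^ (N + 1)) :
    (fun ε => x T ε - melnikovExpansion F k T z ε) =o[𝓝[>] 0] fun ε => ε ^ N := by
  obtain ⟨ρ, hρ, hρD⟩ := Metric.nhds_basis_closedBall.mem_iff.mp (hD.mem_nhds hz)
  -- Treating `(t, ε)` as a parameter yields one Lipschitz constant for the field, valid for all `t
  -- ∈ [0, T]` and `ε ∈ [0, 1]`.
  have hΦ : ContDiffOn ℝ ∞ (fun q : (ℝ × ℝ) × EuclideanSpace ℝ (Fin n) =>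
      ∑ i ∈ Finset.Icc 1 k, q.1.2 ^ i • F i q.1.1 q.2) (univ ×ˢ D) :=
    ContDiffOn.sum fun i hi => ((contDiff_snd.comp contDiff_fst).pow i).contDiffOn.smul
      ((hF i hi).comp (f := fun q : (ℝ × ℝ) × EuclideanSpace ℝ (Fin n) => (q.1.1, q.2))
        (by fun_prop) (fun q hq => ⟨mem_univ _, hq.2⟩))
  obtain ⟨L, hL0, hL⟩ := exists_uniform_lipschitz hD hΦ
    ((isCompact_Icc (a := (0 : ℝ)) (b := T)).prod (isCompact_Icc (a := (0 : ℝ)) (b := 1)))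
    (isCompact_closedBall z ρ) (convex_closedBall z ρ) hρD
  obtain ⟨δ₁, hδ₁, h1⟩ := hball ρ hρ
  obtain ⟨δ₂, hδ₂, h2⟩ := nearIdentity_mem_ball hD
    (contDiffOn_melnikovExpansion_coeff hD hF le_rfl) T (singleton_subset_iff.mpr hz)
    isCompact_singleton hρ
  obtain ⟨δ₃, hδ₃, C', h3⟩ := melnikovExpansion_residual_bound hD hF T hz
  set δ' := min (min δ δ₁) (min (min δ₂ δ₃) 1) with hδ'
  have hδ'0 : 0 < δ' := by positivity
  have hbound : ∀ ε ∈ Ioc 0 δ', ‖x T ε - melnikovExpansion F k T z ε‖ ≤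
      ((|C| + |C'|) / (L + 1) * (Real.exp ((L + 1) * T) - 1)) * ε ^ (N + 1) := by
    intro ε hε
    have hε0 := hε.1
    have hle := hε.2
    simp only [hδ', le_min_iff] at hle
    obtain ⟨⟨e0, e1⟩, ⟨e2, e3⟩, e4⟩ := hle
    have hd : ∀ t ∈ Icc 0 T, HasDerivAt (fun s => x s ε - melnikovExpansion F k s z ε)
        (x' t ε - deriv (fun s => melnikovExpansion F k s z ε) t) t := fun t ht =>
      (hxd t ht ε ⟨hε0, e0⟩).sub (h3 t ht ε ⟨hε0.le, e3⟩).1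
    -- Both curves start at `z`, so the initial gap is `0`. The rate `L + 1` is nonzero even when `L
    -- = 0`, which selects the exponential form of the bound.
    have hg := norm_le_gronwallBound_of_norm_deriv_right_le (a := 0) (b := T) (δ := 0)
      (K := L + 1) (ε := (|C| + |C'|) * ε ^ (N + 1))
      (f := fun s => x s ε - melnikovExpansion F k s z ε)
      (f' := fun t => x' t ε - deriv (fun s => melnikovExpansion F k s z ε) t)
      (fun t ht => (hd t ht).continuousAt.continuousWithinAt)
      (fun t ht => (hd t (Ico_subset_Icc_self ht)).hasDerivWithinAt)
      (by
        have : melnikovExpansion F k 0 z ε = z := by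
          rw [melnikovExpansion, nearIdentity, Finset.sum_eq_zero, add_zero]
          intro i _
          simp [melnikovCoeff, melnikovY_eq_integral]
        simp [hx0 ε ⟨hε0, e0⟩, this])
      (by
        intro t ht'
        have ht := Ico_subset_Icc_self ht'
        have a1 := hres t ht ε ⟨hε0, e0⟩
        have a2 := (h3 t ht ε ⟨hε0.le, e3⟩).2
        have a3 := hL (t, ε) ⟨ht, hε0.le, e4⟩ _
          (Metric.ball_subset_closedBall (h1 t ht ε ⟨hε0, e1⟩)) _
          (Metric.ball_subset_closedBall (h2 t ht z rfl ε ⟨hε0.le, e2⟩))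
        dsimp only at a3
        have a4 : C * ε ^ (N + 1) ≤ |C| * ε ^ (N + 1) := by gcongr; exact le_abs_self C
        have a5 : C' * ε ^ (k + 1) ≤ |C'| * ε ^ (N + 1) :=
          mul_le_mul (le_abs_self C') (pow_le_pow_of_le_one hε0.le e4 (by omega)) (by positivity)
            (abs_nonneg _)
        have a6 : ‖x' t ε - deriv (fun s => melnikovExpansion F k s z ε) t‖ ≤ _ :=
          (congrArg norm (show _ = (x' t ε - ∑ i ∈ Finset.Icc 1 k, ε ^ i • F i t (x t ε)) +
            (∑ i ∈ Finset.Icc 1 k, ε ^ i • F i t (x t ε) -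
              ∑ i ∈ Finset.Icc 1 k, ε ^ i • F i t (melnikovExpansion F k t z ε)) -
            (deriv (fun s => melnikovExpansion F k s z ε) t -
              ∑ i ∈ Finset.Icc 1 k, ε ^ i • F i t (melnikovExpansion F k t z ε)) by
                abel)).le.trans
            ((norm_sub_le _ _).trans (add_le_add_left (norm_add_le _ _) _))
        have a7 := norm_nonneg (x t ε - melnikovExpansion F k t z ε)
        change ‖_ - ∑ i ∈ Finset.Icc 1 k, ε ^ i • F i t (melnikovExpansion F k t z ε)‖ ≤
          L * ‖x t ε - melnikovExpansion F k t z ε‖ at a3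
        linarith) T ⟨hT.le, le_rfl⟩
    rw [gronwallBound_of_K_ne_0 (by positivity)] at hg
    refine hg.trans (le_of_eq ?_)
    simp only [sub_zero]; ring
  have hO : (fun ε => x T ε - melnikovExpansion F k T z ε) =O[𝓝[>] 0] fun ε => ε ^ (N + 1) := by
    refine IsBigO.of_bound ((|C| + |C'|) / (L + 1) * (Real.exp ((L + 1) * T) - 1)) ?_
    filter_upwards [Ioc_mem_nhdsGT hδ'0] with ε hε
    rw [norm_pow, Real.norm_of_nonneg hε.1.le]
    exact hbound ε hε
  exact hO.trans_isLittleO ((isLittleO_pow_pow (Nat.lt_succ_self N)).mono nhdsWithin_le_nhds)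
end

/-! ### Expansion of the averaged flow up to order `2ℓ`. -/

theorem isLittleO_pow_smul_const {G : Type*} [NormedAddCommGroup G] [NormedSpace ℝ G] {i m : ℕ}
    (h : m < i) (a : G) : (fun ε : ℝ => ε ^ i • a) =o[𝓝[>] 0] fun ε => ε ^ m := by
  have h1 : (fun ε : ℝ => ε ^ i) =o[𝓝[>] 0] fun ε => ε ^ m :=
    (isLittleO_pow_pow h).mono nhdsWithin_le_nhds
  have := h1.smul_isBigO (isBigO_const_const a (one_ne_zero (α := ℝ)) (𝓝[>] (0 : ℝ)))
  simpa using this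

/-- Taylor coefficients, at `z`, of the solution of `z' = ∑ ε^i g_i(z)`, up to order `2ℓ`, in the
case where `g_1, …, g_{ℓ-1}` vanish. -/
noncomputable def averagedCoeff (ℓ : ℕ)
    (g : ℕ → EuclideanSpace ℝ (Fin n) → EuclideanSpace ℝ (Fin n)) (i : ℕ) (t : ℝ)
    (z : EuclideanSpace ℝ (Fin n)) : EuclideanSpace ℝ (Fin n) :=
  t • g i z + if i = 2 * ℓ then (t ^ 2 / 2) • fderiv ℝ (g ℓ) z (g ℓ z) else 0

section
variable {k ℓ : ℕ} {D : Set (EuclideanSpace ℝ (Fin n))} (hD : IsOpen D)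
  {g : ℕ → EuclideanSpace ℝ (Fin n) → EuclideanSpace ℝ (Fin n)}
  (hg : ∀ i ∈ Finset.Icc 1 k, ContDiffOn ℝ ∞ (g i) D)
  (hℓ : ℓ ∈ Finset.Icc 1 k)
include hD hg hℓ

theorem contDiffOn_averagedCoeff : ∀ i ∈ Finset.Icc 1 k, ContDiffOn ℝ ∞
    (fun p : ℝ × EuclideanSpace ℝ (Fin n) => averagedCoeff ℓ g i p.1 p.2) (univ ×ˢ D) := by
  intro i hi
  have hgi : ∀ i ∈ Finset.Icc 1 k,
      ContDiffOn ℝ ∞ (fun p : ℝ × EuclideanSpace ℝ (Fin n) => g i p.2) (univ ×ˢ D) := fun i hi =>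
    (hg i hi).comp (by fun_prop) (fun _ hp => hp.2)
  unfold averagedCoeff
  refine (contDiff_fst.contDiffOn.smul (hgi i hi)).add ?_
  split_ifs
  · refine ContDiffOn.smul ((contDiff_fst.pow 2).div_const 2).contDiffOn (ContDiffOn.clm_apply ?_ (hgi ℓ hℓ))
    exact ((hg ℓ hℓ).fderiv_of_isOpen hD (by simp)).comp (by fun_prop) (fun _ hp => hp.2)
  · exact contDiffOn_const

/-- The displacement is `ε^ℓ t g_ℓ(z) + o(ε^ℓ)`. For `i > ℓ` the change of `ε^i g_i` is thus
`O(ε^{i+ℓ})`, beyond order `2ℓ`; for `i = ℓ` linearization produces `ε^{2ℓ} t dg_ℓ·g_ℓ`, the time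
derivative of the quadratic term in `averagedCoeff`. The minimum with `k` accounts for truncation:
when `2ℓ > k` the correction is absent and already negligible. -/
theorem averagedExpansion_residual_isLittleO
    (h0 : ∀ i ∈ Finset.Icc 1 (ℓ - 1), ∀ z ∈ D, g i z = 0) (t : ℝ)
    {z : EuclideanSpace ℝ (Fin n)} (hz : z ∈ D) :
    (fun ε => deriv (fun s => nearIdentity k (averagedCoeff ℓ g) s z ε) t -
      ∑ i ∈ Finset.Icc 1 k, ε ^ i • g i (nearIdentity k (averagedCoeff ℓ g) t z ε))
      =o[𝓝[>] 0] fun ε => ε ^ (min k (2 * ℓ)) := by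
  set V := fun ε => nearIdentity k (averagedCoeff ℓ g) t z ε with hV
  have hℓ' := Finset.mem_Icc.mp hℓ
  have hlow : ∀ i ∈ Finset.Icc 1 k, i < ℓ → ∀ z ∈ D, g i z = 0 := fun i hi hil =>
    h0 i (by rw [Finset.mem_Icc] at hi ⊢; omega)
  have hVc : ContDiff ℝ ∞ V := by rw [hV]; unfold nearIdentity; fun_prop
  have hV0 : V 0 = z := nearIdentity_zero _ _ _ _
  have hVt : Tendsto V (𝓝[>] 0) (𝓝 z) := by
    have := hVc.continuous.tendsto 0
    rw [hV0] at this
    exact this.mono_left nhdsWithin_le_nhds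
  have hVD : ∀ᶠ ε in 𝓝[>] 0, V ε ∈ D := hVt (hD.mem_nhds hz)
  have hlead : (fun ε => V ε - z - ε ^ ℓ • t • g ℓ z) =o[𝓝[>] 0] fun ε => ε ^ ℓ := by
    have : (fun ε : ℝ => ∑ i ∈ (Finset.Icc 1 k).erase ℓ, ε ^ i • averagedCoeff ℓ g i t z)
        =o[𝓝[>] 0] fun ε => ε ^ ℓ := by
      refine IsLittleO.fun_sum fun i hi => ?_
      rw [Finset.mem_erase] at hi
      rcases lt_or_gt_of_ne hi.1 with h | h
      · have : averagedCoeff ℓ g i t z = 0 := by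
          rw [averagedCoeff, hlow i hi.2 h z hz, if_neg (by omega)]; simp
        simp only [this, smul_zero]
        exact isLittleO_zero _ _
      · exact isLittleO_pow_smul_const h _
    refine this.congr_left fun ε => ?_
    have hc : averagedCoeff ℓ g ℓ t z = t • g ℓ z := by
      rw [averagedCoeff, if_neg (by omega), add_zero]
    rw [hV]
    dsimp only
    rw [nearIdentity, ← Finset.add_sum_erase _ _ hℓ, hc]
    abel
  have hVO : (fun ε => V ε - z) =O[𝓝[>] 0] fun ε => ε ^ ℓ := by
    have h1 : (fun ε : ℝ => ε ^ ℓ • t • g ℓ z) =O[𝓝[>] 0] fun ε => ε ^ ℓ := by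
      have := (isBigO_refl (fun ε : ℝ => ε ^ ℓ) (𝓝[>] 0)).smul
        (isBigO_const_const (t • g ℓ z) (one_ne_zero (α := ℝ)) (𝓝[>] (0 : ℝ)))
      simpa using this
    exact (hlead.isBigO.add h1).congr_left fun ε => by abel
  have hdiff : ∀ i ∈ Finset.Icc 1 k, HasFDerivAt (g i) (fderiv ℝ (g i) z) z := fun i hi =>
    (((hg i hi).contDiffAt (hD.mem_nhds hz)).differentiableAt (by simp)).hasFDerivAt
  have hN : (fun ε : ℝ => ε ^ (2 * ℓ)) =O[𝓝[>] 0] fun ε => ε ^ (min k (2 * ℓ)) := by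
    rcases (min_le_right k (2 * ℓ)).eq_or_lt with h | h
    · rw [h]
    · exact (isLittleO_pow_pow h).isBigO.mono nhdsWithin_le_nhds
  have hterm : ∀ i ∈ Finset.Icc 1 k, i ≠ ℓ → (fun ε : ℝ => ε ^ i • (g i z - g i (V ε)))
      =o[𝓝[>] 0] fun ε => ε ^ (min k (2 * ℓ)) := by
    intro i hi hne
    rcases lt_or_gt_of_ne hne with h | h
    · refine (isLittleO_zero _ _).congr' ?_ EventuallyEq.rfl
      filter_upwards [hVD] with ε hε
      rw [hlow i hi h z hz, hlow i hi h _ hε, sub_zero, smul_zero]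
    · have h1 : (fun ε => g i z - g i (V ε)) =O[𝓝[>] 0] fun ε => ε ^ ℓ :=
        (((hdiff i hi).isBigO_sub.comp_tendsto hVt).trans hVO).neg_left.congr_left
          fun ε => by simp
      have h2 := (isBigO_refl (fun ε : ℝ => ε ^ i) (𝓝[>] 0)).smul h1
      refine IsBigO.trans_isLittleO (h2.congr_right fun ε => by rw [smul_eq_mul, ← pow_add])
        (((isLittleO_pow_pow ?_).mono nhdsWithin_le_nhds).trans_isBigO hN)
      omega
  have hmain : (fun ε : ℝ => ε ^ ℓ • (g ℓ z - g ℓ (V ε)) +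
      ε ^ (2 * ℓ) • t • fderiv ℝ (g ℓ) z (g ℓ z)) =o[𝓝[>] 0] fun ε => ε ^ (2 * ℓ) := by
    have h1 : (fun ε => g ℓ (V ε) - g ℓ z - fderiv ℝ (g ℓ) z (V ε - z)) =o[𝓝[>] 0]
        fun ε => ε ^ ℓ := ((hdiff ℓ hℓ).isLittleO.comp_tendsto hVt).trans_isBigO hVO
    have h2 : (fun ε => fderiv ℝ (g ℓ) z (V ε - z - ε ^ ℓ • t • g ℓ z)) =o[𝓝[>] 0]
        fun ε => ε ^ ℓ := ((fderiv ℝ (g ℓ) z).isBigO_comp _ _).trans_isLittleO hlead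
    have h3 := (isBigO_refl (fun ε : ℝ => ε ^ ℓ) (𝓝[>] 0)).smul_isLittleO (h1.add h2).neg_left
    refine h3.congr (fun ε => ?_) (fun ε => by rw [smul_eq_mul, ← pow_add, two_mul])
    simp only [map_sub, map_smul, two_mul, pow_add, mul_smul, ← smul_add]
    congr 1
    abel
  have hextra : (fun ε : ℝ => (∑ i ∈ Finset.Icc 1 k, ε ^ i •
      (if i = 2 * ℓ then t • fderiv ℝ (g ℓ) z (g ℓ z) else 0)) -
      ε ^ (2 * ℓ) • t • fderiv ℝ (g ℓ) z (g ℓ z)) =o[𝓝[>] 0] fun ε => ε ^ (min k (2 * ℓ)) := by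
    by_cases hk : 2 * ℓ ≤ k
    · refine (isLittleO_zero _ _).congr_left fun ε => ?_
      have : 2 * ℓ ∈ Finset.Icc 1 k := Finset.mem_Icc.mpr ⟨by omega, hk⟩
      simp only [smul_ite, smul_zero, Finset.sum_ite_eq', if_pos this, sub_self]
    · refine (isLittleO_pow_smul_const (m := min k (2 * ℓ)) (i := 2 * ℓ) (by omega)
        (t • fderiv ℝ (g ℓ) z (g ℓ z))).neg_left.congr_left fun ε => ?_
      have : 2 * ℓ ∉ Finset.Icc 1 k := fun h => hk (Finset.mem_Icc.mp h).2
      simp only [smul_ite, smul_zero, Finset.sum_ite_eq', if_neg this, zero_sub]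
  have hall := (IsLittleO.fun_sum (s := (Finset.Icc 1 k).erase ℓ) (fun i hi =>
    hterm i (Finset.mem_of_mem_erase hi) (Finset.ne_of_mem_erase hi))).add
    ((hmain.trans_isBigO hN).add hextra)
  refine hall.congr_left fun ε => ?_
  have hderiv : deriv (fun s => nearIdentity k (averagedCoeff ℓ g) s z ε) t =
      ∑ i ∈ Finset.Icc 1 k, ε ^ i • (g i z +
        if i = 2 * ℓ then t • fderiv ℝ (g ℓ) z (g ℓ z) else 0) := by
    refine HasDerivAt.deriv ?_
    unfold nearIdentity averagedCoeff
    refine HasDerivAt.const_add _ (HasDerivAt.fun_sum fun i hi => HasDerivAt.fun_const_smul _ ?_)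
    refine HasDerivAt.add ?_ ?_
    · simpa using (hasDerivAt_id t).smul_const (g i z)
    · split_ifs
      · refine HasDerivAt.smul_const ?_ _
        refine (((hasDerivAt_id t).pow 2).div_const 2).congr_deriv ?_
        simp
      · exact hasDerivAt_const _ _
  rw [hderiv]
  simp only [smul_add, Finset.sum_add_distrib]
  rw [← Finset.add_sum_erase _ (fun i => ε ^ i • g i z) hℓ,
    ← Finset.add_sum_erase _ (fun i => ε ^ i • g i (V ε)) hℓ]
  simp only [smul_sub, Finset.sum_sub_distrib]
  abel

theorem averagedExpansion_residual_bound
    (h0 : ∀ i ∈ Finset.Icc 1 (ℓ - 1), ∀ z ∈ D, g i z = 0) (T : ℝ)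
    {z : EuclideanSpace ℝ (Fin n)} (hz : z ∈ D) :
    ∃ δ > 0, ∃ C, ∀ t ∈ Icc 0 T, ∀ ε ∈ Icc 0 δ,
      HasDerivAt (fun s => nearIdentity k (averagedCoeff ℓ g) s z ε)
        (deriv (fun s => nearIdentity k (averagedCoeff ℓ g) s z ε) t) t ∧
      ‖deriv (fun s => nearIdentity k (averagedCoeff ℓ g) s z ε) t -
        ∑ i ∈ Finset.Icc 1 k, ε ^ i • g i (nearIdentity k (averagedCoeff ℓ g) t z ε)‖ ≤
          C * ε ^ (min k (2 * ℓ) + 1) := by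
  have hu := contDiffOn_averagedCoeff hD hg hℓ
  -- The averaged field plays the role of a time-independent `F`, and the zero field that of `g`, so
  -- the residual is the defect in the averaged equation.
  obtain ⟨δ, hδ, C, h⟩ := residual_uniform_bound hD (F := fun i _ => g i)
    (fun i hi => (hg i hi).comp contDiff_snd.contDiffOn (fun _ hp => hp.2)) hu
    (g := fun _ _ => 0) (fun _ _ => contDiffOn_const) (N := min k (2 * ℓ)) (fun t w hw => by
      simpa [averagingResidual] using averagedExpansion_residual_isLittleO hD hg hℓ h0 t hw)
    T (singleton_subset_iff.mpr hz) isCompact_singleton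
  refine ⟨δ, hδ, C, fun t ht ε hε => ⟨?_, by simpa [averagingResidual] using h t ht z rfl ε hε⟩⟩
  exact (hasDerivAt_nearIdentity_comp hD hu (γ := fun _ => z) hz
    (hasDerivAt_const t z) ε).differentiableAt.hasDerivAt

/-! ### Comparison of the two expansions at time `T`. -/

/-- The transformation maps the truncated averaged solution to an approximate solution of the
original equation with initial value `z`, and it is the identity at time `T`. Hence the truncated
averaged solution and the Melnikov expansion agree at time `T` up to `o(ε^{min(k, 2ℓ)})`. -/
theorem melnikov_eq_averagedCoeff {T ε₀ : ℝ} (hT : 0 < T)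
    {F : ℕ → ℝ → EuclideanSpace ℝ (Fin n) → EuclideanSpace ℝ (Fin n)}
    (hF : ∀ i ∈ Finset.Icc 1 k,
      ContDiffOn ℝ ∞ (fun p : ℝ × EuclideanSpace ℝ (Fin n) => F i p.1 p.2) (univ ×ˢ D))
    {R : ℝ → EuclideanSpace ℝ (Fin n) → ℝ → EuclideanSpace ℝ (Fin n)}
    (hR : ContinuousOn (fun p : ℝ × EuclideanSpace ℝ (Fin n) × ℝ => R p.1 p.2.1 p.2.2)
      (univ ×ˢ D ×ˢ Icc 0 ε₀))
    {u : ℕ → ℝ → EuclideanSpace ℝ (Fin n) → EuclideanSpace ℝ (Fin n)}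
    (h : IsStroboscopicTransformation T ε₀ D k F R u g)
    (h0 : ∀ i ∈ Finset.Icc 1 (ℓ - 1), ∀ z ∈ D, g i z = 0)
    {z : EuclideanSpace ℝ (Fin n)} (hz : z ∈ D) {i : ℕ} (hi : i ∈ Finset.Icc 1 k)
    (hiℓ : i ≤ 2 * ℓ) : melnikov T F i z = averagedCoeff ℓ g i T z := by
  have hu := h.smooth_u
  have hv := contDiffOn_averagedCoeff hD hg hℓ
  obtain ⟨ρ, hρ, hρD⟩ := Metric.nhds_basis_closedBall.mem_iff.mp (hD.mem_nhds hz)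
  set K := Metric.closedBall z ρ with hKdef
  have hK : IsCompact K := isCompact_closedBall z ρ
  obtain ⟨r, hr⟩ := h.transforms
  obtain ⟨ε₁, hε₁, Cr, hr⟩ := hr K hρD hK
  obtain ⟨δ₁, hδ₁, CZ, hZ⟩ := averagedExpansion_residual_bound hD hg hℓ h0 T hz
  obtain ⟨δ₂, hδ₂, hZball⟩ := nearIdentity_mem_ball hD hv T (singleton_subset_iff.mpr hz)
    isCompact_singleton hρ
  have hcomp : IsCompact ((Icc 0 T ×ˢ K) ×ˢ Icc 0 ε₁) :=
    ((isCompact_Icc).prod hK).prod isCompact_Icc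
  have hsub : ((Icc 0 T ×ˢ K) ×ˢ Icc 0 ε₁) ⊆ ((univ ×ˢ D) ×ˢ univ) :=
    prod_mono (prod_mono (subset_univ _) hρD) (subset_univ _)
  obtain ⟨B, hB⟩ := hcomp.exists_bound_of_continuousOn
    ((contDiffOn_fderiv_nearIdentity hD hu).continuousOn.mono hsub)
  obtain ⟨CR, hCR⟩ := hcomp.exists_bound_of_continuousOn (hR.comp
    (f := fun q : (ℝ × EuclideanSpace ℝ (Fin n)) × ℝ =>
      (q.1.1, nearIdentity k u q.1.1 q.1.2 q.2, q.2))
    (ContinuousOn.prodMk (by fun_prop) (ContinuousOn.prodMk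
      ((contDiffOn_nearIdentity hu).continuousOn.mono hsub) (by fun_prop)))
    (fun q hq => ⟨mem_univ _, (hr q.1.1 q.1.2 hq.1.2 q.2 hq.2).1, hq.2.1, hq.2.2.trans hε₁.2⟩))
  set Z := fun t ε => nearIdentity k (averagedCoeff ℓ g) t z ε with hZdef
  set N := min k (2 * ℓ) with hNdef
  set δ := min (min δ₁ δ₂) (min ε₁ 1) with hδdef
  have hδ : 0 < δ := lt_min (lt_min hδ₁ hδ₂) (lt_min hε₁.1 one_pos)
  have hZK : ∀ t ∈ Icc 0 T, ∀ ε ∈ Ioc 0 δ, Z t ε ∈ K := fun t ht ε hε =>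
    Metric.ball_subset_closedBall (hZball t ht z rfl ε ⟨hε.1.le, hε.2.trans
      ((min_le_left _ _).trans (min_le_right _ _))⟩)
  have hx := sub_melnikovExpansion_isLittleO hD hF hT hz (N := N) (min_le_left _ _)
    (x := fun t ε => nearIdentity k u t (Z t ε) ε)
    (x' := fun t ε => deriv (fun s => nearIdentity k u s (Z t ε) ε) t +
      fderiv ℝ (fun w => nearIdentity k u t w ε) (Z t ε) (deriv (fun s => Z s ε) t))
    -- The three contributions are the remainder `R`, the remainder `r` pushed forward by `∂_z U`
    -- (bounded by `B`), and the defect of `Z` pushed forward likewise.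
    (δ := δ) (C := |CR| + |B| * |Cr| + |B| * |CZ|) hδ
    (by
      intro ε hε
      have hZ0 : Z 0 ε = z := by
        rw [hZdef]
        dsimp only
        rw [nearIdentity, Finset.sum_eq_zero, add_zero]
        intro i _
        simp [averagedCoeff]
      rw [hZ0]
      exact h.stroboscopic z hz ε ⟨hε.1.le, hε.2.trans
        ((min_le_right _ _).trans ((min_le_left _ _).trans hε₁.2))⟩)
    (fun t ht ε hε => hasDerivAt_nearIdentity_comp hD hu (γ := fun s => Z s ε)
      (hρD (hZK t ht ε hε))
      (hZ t ht ε ⟨hε.1.le, hε.2.trans ((min_le_left _ _).trans (min_le_left _ _))⟩).1 ε)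
    (by
      intro ρ' hρ'
      obtain ⟨a, ha, hUa⟩ := nearIdentity_mem_ball hD hu T hρD hK (half_pos hρ')
      obtain ⟨b, hb, hZb⟩ := nearIdentity_mem_ball hD hv T (singleton_subset_iff.mpr hz)
        isCompact_singleton (half_pos hρ')
      refine ⟨min δ (min a b), by positivity, fun t ht ε hε => ?_⟩
      have e := hε.2
      simp only [le_min_iff] at e
      have h1 := hUa t ht _ (hZK t ht ε ⟨hε.1, e.1⟩) ε ⟨hε.1.le, e.2.1⟩
      have h2 := hZb t ht z rfl ε ⟨hε.1.le, e.2.2⟩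
      rw [Metric.mem_ball] at h1 h2 ⊢
      calc _ ≤ _ := dist_triangle _ (Z t ε) _
        _ < ρ' / 2 + ρ' / 2 := add_lt_add h1 h2
        _ = ρ' := add_halves ρ')
    (by
      intro t ht ε hε
      have e := hε.2
      simp only [hδdef, le_min_iff] at e
      obtain ⟨⟨e1, e2⟩, e3, e4⟩ := e
      have hε0 := hε.1.le
      have hzK := hZK t ht ε hε
      obtain ⟨_, hrC, heq⟩ := hr t (Z t ε) hzK ε ⟨hε0, e3⟩
      have hres := (hZ t ht ε ⟨hε0, e1⟩).2
      have hBt := hB ((t, Z t ε), ε) ⟨⟨ht, hzK⟩, hε0, e3⟩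
      have hRt := hCR ((t, Z t ε), ε) ⟨⟨ht, hzK⟩, hε0, e3⟩
      dsimp only [Function.comp_apply] at hBt hRt
      rw [perturbedField, map_add, map_smul] at heq
      set A := fderiv ℝ (fun w => nearIdentity k u t w ε) (Z t ε) with hA
      set S := ∑ i ∈ Finset.Icc 1 k, ε ^ i • g i (Z t ε) with hS
      set x := nearIdentity k u t (Z t ε) ε with hxdef
      -- The transformation identity is used at the point `Z(t,ε)`, with `Z'` in place of the
      -- averaged field; the mismatch `Z' - S` enters linearly through `A`.
      have hkey : deriv (fun s => nearIdentity k u s (Z t ε) ε) t + A (deriv (fun s => Z s ε) t) -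
          ∑ i ∈ Finset.Icc 1 k, ε ^ i • F i t x = ε ^ (k + 1) • R t x ε -
          ε ^ (k + 1) • A (r t (Z t ε) ε) + A (deriv (fun s => Z s ε) t - S) := by
        rw [← add_assoc] at heq
        rw [map_sub, eq_sub_of_add_eq (eq_sub_of_add_eq heq)]
        abel
      rw [hkey]
      have hpow : ε ^ (k + 1) ≤ ε ^ (N + 1) :=
        pow_le_pow_of_le_one hε0 e4 (Nat.succ_le_succ (min_le_left _ _))
      have hp : 0 ≤ ε ^ (k + 1) := by positivity
      have b1 : ‖ε ^ (k + 1) • R t x ε‖ ≤ ε ^ (N + 1) * |CR| := by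
        rw [norm_smul, Real.norm_of_nonneg hp]
        exact mul_le_mul hpow (hRt.trans (le_abs_self _)) (norm_nonneg _) (by positivity)
      have b2 : ‖ε ^ (k + 1) • A (r t (Z t ε) ε)‖ ≤ ε ^ (N + 1) * (|B| * |Cr|) := by
        rw [norm_smul, Real.norm_of_nonneg hp]
        refine mul_le_mul hpow ?_ (norm_nonneg _) (by positivity)
        exact (A.le_opNorm _).trans (mul_le_mul (hBt.trans (le_abs_self _))
          (hrC.trans (le_abs_self _)) (norm_nonneg _) (abs_nonneg _))
      have b3 : ‖A (deriv (fun s => Z s ε) t - S)‖ ≤ |B| * (|CZ| * ε ^ (N + 1)) := by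
        refine (A.le_opNorm _).trans (mul_le_mul (hBt.trans (le_abs_self _))
          (hres.trans ?_) (norm_nonneg _) (abs_nonneg _))
        exact mul_le_mul_of_nonneg_right (le_abs_self _) (by positivity)
      refine (norm_add_le _ _).trans ((add_le_add (norm_sub_le _ _) le_rfl).trans ?_)
      linarith)
  -- Periodicity carries the stroboscopic condition from time `0` to time `T`.
  have hper : ∀ᶠ ε in 𝓝[>] 0, nearIdentity k u T (Z T ε) ε = Z T ε := by
    filter_upwards [Ioc_mem_nhdsGT hδ] with ε hε
    have hzD := hρD (hZK T ⟨hT.le, le_rfl⟩ ε hε)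
    conv_rhs => rw [← h.stroboscopic _ hzD ε ⟨hε.1.le, hε.2.trans
        ((min_le_right _ _).trans ((min_le_left _ _).trans hε₁.2))⟩]
    unfold nearIdentity
    congr 1
    refine Finset.sum_congr rfl fun i hi => ?_
    rw [← h.periodic i hi 0 _ hzD, zero_add]
  have hfin : (fun ε => nearIdentity k (averagedCoeff ℓ g) T z ε -
      nearIdentity k (melnikovCoeff F) T z ε) =o[𝓝[>] 0] fun ε => ε ^ N :=
    hx.congr' (by filter_upwards [hper] with ε hε; rw [hε]; rfl) EventuallyEq.rfl
  exact (nearIdentity_coeff_eq hfin hi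
    (le_min (Finset.mem_Icc.mp hi).2 hiℓ)).symm
end

/-! ### Existence of stroboscopic averaging. -/

theorem isLittleO_pow_smul_of_continuousAt {G : Type*} [NormedAddCommGroup G] [NormedSpace ℝ G]
    {f : ℝ → G} (hf : ContinuousAt f 0) (h0 : f 0 = 0) (m : ℕ) :
    (fun ε : ℝ => ε ^ m • f ε) =o[𝓝[>] 0] fun ε => ε ^ m := by
  have h1 : f =o[𝓝[>] 0] fun _ => (1 : ℝ) := by
    rw [isLittleO_one_iff]
    have := hf.tendsto
    rw [h0] at this
    exact this.mono_left nhdsWithin_le_nhds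
  simpa using (isBigO_refl (fun ε : ℝ => ε ^ m) (𝓝[>] 0)).smul_isLittleO h1

theorem nearIdentity_periodic {k : ℕ} {T : ℝ} {D : Set (EuclideanSpace ℝ (Fin n))}
    {u : ℕ → ℝ → EuclideanSpace ℝ (Fin n) → EuclideanSpace ℝ (Fin n)}
    (huT : ∀ i ∈ Finset.Icc 1 k, ∀ t : ℝ, ∀ z ∈ D, u i (t + T) z = u i t z) (t : ℝ)
    {z : EuclideanSpace ℝ (Fin n)} (hz : z ∈ D) (ε : ℝ) :
    nearIdentity k u (t + T) z ε = nearIdentity k u t z ε := by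
  unfold nearIdentity
  congr 1
  exact Finset.sum_congr rfl fun i hi => by rw [huT i hi t z hz]

theorem fderiv_nearIdentity_periodic {k : ℕ} {T : ℝ} {D : Set (EuclideanSpace ℝ (Fin n))}
    (hD : IsOpen D) {u : ℕ → ℝ → EuclideanSpace ℝ (Fin n) → EuclideanSpace ℝ (Fin n)}
    (huT : ∀ i ∈ Finset.Icc 1 k, ∀ t : ℝ, ∀ z ∈ D, u i (t + T) z = u i t z) (t : ℝ)
    {z : EuclideanSpace ℝ (Fin n)} (hz : z ∈ D) (ε : ℝ) :
    fderiv ℝ (fun w => nearIdentity k u (t + T) w ε) z =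
      fderiv ℝ (fun w => nearIdentity k u t w ε) z := by
  refine Filter.EventuallyEq.fderiv_eq ?_
  filter_upwards [hD.mem_nhds hz] with w hw using nearIdentity_periodic huT t hw ε

theorem averagingResidual_periodic {k : ℕ} {T : ℝ} {D : Set (EuclideanSpace ℝ (Fin n))}
    (hD : IsOpen D) {F : ℕ → ℝ → EuclideanSpace ℝ (Fin n) → EuclideanSpace ℝ (Fin n)}
    (hFT : ∀ i ∈ Finset.Icc 1 k, ∀ t : ℝ, ∀ x ∈ D, F i (t + T) x = F i t x)
    {u : ℕ → ℝ → EuclideanSpace ℝ (Fin n) → EuclideanSpace ℝ (Fin n)}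
    (huT : ∀ i ∈ Finset.Icc 1 k, ∀ t : ℝ, ∀ z ∈ D, u i (t + T) z = u i t z)
    (g : ℕ → EuclideanSpace ℝ (Fin n) → EuclideanSpace ℝ (Fin n)) (t : ℝ)
    {z : EuclideanSpace ℝ (Fin n)} (hz : z ∈ D) {ε : ℝ} (hU : nearIdentity k u t z ε ∈ D) :
    averagingResidual k F u g (t + T) z ε = averagingResidual k F u g t z ε := by
  have hd : deriv (fun s => nearIdentity k u s z ε) (t + T) =
      deriv (fun s => nearIdentity k u s z ε) t := by
    rw [← deriv_comp_add_const]
    congr 1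
    funext s
    exact nearIdentity_periodic huT s hz ε
  unfold averagingResidual
  rw [hd, fderiv_nearIdentity_periodic hD huT t hz, nearIdentity_periodic huT t hz]
  congr 1
  exact Finset.sum_congr rfl fun i hi => by rw [hFT i hi t _ hU]

/-- A smooth periodic function `c` is, up to its average, the time derivative of a smooth periodic
function. -/
theorem exists_periodic_primitive {T : ℝ} (hT : 0 < T) {D : Set (EuclideanSpace ℝ (Fin n))}
    (hD : IsOpen D) {c : ℝ × EuclideanSpace ℝ (Fin n) → EuclideanSpace ℝ (Fin n)}
    (hc : ContDiffOn ℝ ∞ c (univ ×ˢ D)) (hcT : ∀ t, ∀ z ∈ D, c (t + T, z) = c (t, z)) :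
    ∃ (v : ℝ → EuclideanSpace ℝ (Fin n) → EuclideanSpace ℝ (Fin n))
      (h : EuclideanSpace ℝ (Fin n) → EuclideanSpace ℝ (Fin n)),
      ContDiffOn ℝ ∞ (fun p : ℝ × EuclideanSpace ℝ (Fin n) => v p.1 p.2) (univ ×ˢ D) ∧
      ContDiffOn ℝ ∞ h D ∧ (∀ t, ∀ z ∈ D, v (t + T) z = v t z) ∧ (∀ z ∈ D, v 0 z = 0) ∧
      ∀ t, ∀ z ∈ D, HasDerivAt (fun s => v s z) (c (t, z) - h z) t := by
  set h : EuclideanSpace ℝ (Fin n) → EuclideanSpace ℝ (Fin n) :=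
    fun z => (1 / T) • ∫ s in (0 : ℝ)..T, c (s, z) with hh
  have hhs : ContDiffOn ℝ ∞ h D :=
    (contDiffOn_intervalIntegral_param hD 0 T (c := fun q => c (q.2, q.1))
      (hc.comp (by fun_prop) (fun q hq => ⟨mem_univ _, hq.1⟩))).const_smul _
  have hφ : ContDiffOn ℝ ∞ (fun p : ℝ × EuclideanSpace ℝ (Fin n) => c p - h p.2) (univ ×ˢ D) :=
    hc.sub (hhs.comp (by fun_prop) (fun q hq => hq.2))
  have hcc : ∀ z ∈ D, Continuous fun s => c (s, z) := fun z hz =>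
    hc.continuousOn.comp_continuous (f := fun s => (s, z)) (by fun_prop)
      (fun s => ⟨mem_univ _, hz⟩)
  have hφc : ∀ z ∈ D, Continuous fun s => c (s, z) - h z := fun z hz =>
    (hcc z hz).sub continuous_const
  refine ⟨fun t z => ∫ s in (0 : ℝ)..t, (c (s, z) - h z), h, contDiffOn_primitive_param hD hφ, hhs,
    fun t z hz => ?_, fun z _ => by simp, fun t z hz =>
      ((hφc z hz).integral_hasStrictDerivAt 0 t).hasDerivAt⟩
  have hper : Function.Periodic (fun s => c (s, z) - h z) T := fun s => by
    simp only [hcT s z hz]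
  have hint : ∀ a b, IntervalIntegrable (fun s => c (s, z) - h z) volume a b := fun a b =>
    (hφc z hz).intervalIntegrable a b
  -- Subtracting the mean makes the integral over one period vanish, which is what makes the
  -- primitive periodic.
  have h0 : ∫ s in (0 : ℝ)..T, (c (s, z) - h z) = 0 := by
    rw [intervalIntegral.integral_sub ((hcc z hz).intervalIntegrable 0 T) (by simp),
      intervalIntegral.integral_const, hh, sub_zero, smul_smul, mul_one_div_cancel hT.ne',
      one_smul, sub_self]
  have := hper.intervalIntegral_add_eq t 0
  rw [zero_add, h0] at this
  change ∫ s in (0 : ℝ)..(t + T), (c (s, z) - h z) = ∫ s in (0 : ℝ)..t, (c (s, z) - h z)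
  rw [← intervalIntegral.integral_add_adjacent_intervals (hint 0 t) (hint t (t + T)), this,
    add_zero]

section
variable {k : ℕ} {T : ℝ} (hT : 0 < T) {D : Set (EuclideanSpace ℝ (Fin n))} (hD : IsOpen D)
  {F : ℕ → ℝ → EuclideanSpace ℝ (Fin n) → EuclideanSpace ℝ (Fin n)}
  (hF : ∀ i ∈ Finset.Icc 1 k,
    ContDiffOn ℝ ∞ (fun p : ℝ × EuclideanSpace ℝ (Fin n) => F i p.1 p.2) (univ ×ˢ D))

theorem nearIdentity_add_single {m : ℕ} (hm : m ∈ Finset.Icc 1 k)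
    (u : ℕ → ℝ → EuclideanSpace ℝ (Fin n) → EuclideanSpace ℝ (Fin n))
    (v : ℝ → EuclideanSpace ℝ (Fin n) → EuclideanSpace ℝ (Fin n)) (t : ℝ)
    (z : EuclideanSpace ℝ (Fin n)) (ε : ℝ) :
    nearIdentity k (fun i t z => u i t z + if i = m then v t z else 0) t z ε =
      nearIdentity k u t z ε + ε ^ m • v t z := by
  simp only [nearIdentity, smul_add, smul_ite, smul_zero, Finset.sum_add_distrib,
    Finset.sum_ite_eq', if_pos hm, add_assoc]

include hD hF in
-- To leading order, adding `ε^m v` to `U` and `ε^m h` to the averaged field shifts the residual by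
-- `ε^m (∂_t v + h)`. Everything else is of higher order: `∂_z U` tends to the identity, the
-- averaged field tends to `0`, and each `F_i` carries a factor `ε^i` with `i ≥ 1`.
theorem averagingResidual_add_single {m : ℕ} (hm : m ∈ Finset.Icc 1 k)
    {u : ℕ → ℝ → EuclideanSpace ℝ (Fin n) → EuclideanSpace ℝ (Fin n)}
    (hu : ∀ i ∈ Finset.Icc 1 k,
      ContDiffOn ℝ ∞ (fun p : ℝ × EuclideanSpace ℝ (Fin n) => u i p.1 p.2) (univ ×ˢ D))
    (g : ℕ → EuclideanSpace ℝ (Fin n) → EuclideanSpace ℝ (Fin n))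
    {v : ℝ → EuclideanSpace ℝ (Fin n) → EuclideanSpace ℝ (Fin n)}
    (hv : ContDiffOn ℝ ∞ (fun p : ℝ × EuclideanSpace ℝ (Fin n) => v p.1 p.2) (univ ×ˢ D))
    (h : EuclideanSpace ℝ (Fin n) → EuclideanSpace ℝ (Fin n)) {t : ℝ}
    {z v' : EuclideanSpace ℝ (Fin n)} (hz : z ∈ D) (hv' : HasDerivAt (fun s => v s z) v' t) :
    (fun ε => averagingResidual k F (fun i t z => u i t z + if i = m then v t z else 0)
        (fun i z => g i z + if i = m then h z else 0) t z ε -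
      (averagingResidual k F u g t z ε + ε ^ m • (v' + h z))) =o[𝓝[>] 0] fun ε => ε ^ m := by
  have hm' := Finset.mem_Icc.mp hm
  set S : ℝ → EuclideanSpace ℝ (Fin n) := fun ε => ∑ i ∈ Finset.Icc 1 k, ε ^ i • g i z with hS
  have hSc : Continuous S := by rw [hS]; fun_prop
  have hS0 : S 0 = 0 := Finset.sum_eq_zero fun i hi => by
    rw [zero_pow (by have := Finset.mem_Icc.mp hi; omega), zero_smul]
  set A := fun ε => fderiv ℝ (fun w => nearIdentity k u t w ε) z with hA
  set V := fderiv ℝ (v t) z with hV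
  set U := fun ε => nearIdentity k u t z ε with hU
  have hAc : Continuous A :=
    (contDiffOn_fderiv_nearIdentity hD hu).continuousOn.comp_continuous
      (f := fun ε => ((t, z), ε)) (by fun_prop) (fun ε => ⟨⟨mem_univ _, hz⟩, mem_univ _⟩)
  have hA0 : A 0 = ContinuousLinearMap.id ℝ _ := by
    rw [hA]; simp only [nearIdentity_zero]; exact fderiv_fun_id
  have hU0 : U 0 = z := nearIdentity_zero _ _ _ _
  have hUc : Continuous U := by rw [hU]; unfold nearIdentity; fun_prop
  have hUt : Tendsto U (𝓝[>] 0) (𝓝 z) := by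
    have := hUc.tendsto 0
    rw [hU0] at this
    exact this.mono_left nhdsWithin_le_nhds
  have hU't : Tendsto (fun ε => U ε + ε ^ m • v t z) (𝓝[>] 0) (𝓝 z) := by
    have : Tendsto (fun ε : ℝ => U ε + ε ^ m • v t z) (𝓝 0) (𝓝 (U 0 + (0 : ℝ) ^ m • v t z)) :=
      (by fun_prop : Continuous fun ε : ℝ => U ε + ε ^ m • v t z).tendsto 0
    rw [hU0, zero_pow (by omega), zero_smul, add_zero] at this
    exact this.mono_left nhdsWithin_le_nhds
  have e1 : (fun ε : ℝ => ε ^ m • (A ε (h z) - h z)) =o[𝓝[>] 0] fun ε => ε ^ m :=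
    isLittleO_pow_smul_of_continuousAt
      ((hAc.clm_apply continuous_const).sub continuous_const).continuousAt (by simp [hA0]) m
  have e2 : (fun ε : ℝ => ε ^ m • V (S ε + ε ^ m • h z)) =o[𝓝[>] 0] fun ε => ε ^ m :=
    isLittleO_pow_smul_of_continuousAt (V.continuous.comp (by fun_prop)).continuousAt
      (by rw [Function.comp_apply, hS0, zero_pow (by omega), zero_smul, add_zero, map_zero]) m
  have e3 : (fun ε : ℝ => ∑ i ∈ Finset.Icc 1 k, ε ^ i •
      (F i t (U ε + ε ^ m • v t z) - F i t (U ε))) =o[𝓝[>] 0] fun ε => ε ^ m := by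
    refine IsLittleO.fun_sum fun i hi => ?_
    have hst := (((contDiffOn_slice (hF i hi) t).contDiffAt
      (hD.mem_nhds hz)).hasStrictFDerivAt (by simp)).isBigO_sub
    have h1 : (fun ε => F i t (U ε + ε ^ m • v t z) - F i t (U ε)) =O[𝓝[>] 0]
        fun ε => ε ^ m • v t z :=
      (hst.comp_tendsto (hU't.prodMk_nhds hUt)).congr_right fun ε => by simp
    have h2 : (fun ε : ℝ => ε ^ m • v t z) =O[𝓝[>] 0] fun ε => ε ^ m := by
      have := (isBigO_refl (fun ε : ℝ => ε ^ m) (𝓝[>] 0)).smul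
        (isBigO_const_const (v t z) (one_ne_zero (α := ℝ)) (𝓝[>] (0 : ℝ)))
      simpa using this
    have h3 := (isBigO_refl (fun ε : ℝ => ε ^ i) (𝓝[>] 0)).smul (h1.trans h2)
    rw [Finset.mem_Icc] at hi
    refine IsBigO.trans_isLittleO (h3.congr_right fun ε => by rw [smul_eq_mul, ← pow_add])
      ((isLittleO_pow_pow (by omega)).mono nhdsWithin_le_nhds)
  refine ((e1.add e2).sub e3).congr_left fun ε => ?_
  have hUd := hasFDerivAt_nearIdentity hD hu t hz ε
  have hfd : fderiv ℝ (fun w => nearIdentity k u t w ε + ε ^ m • v t w) z =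
      A ε + ε ^ m • V := by
    have hd1 : DifferentiableAt ℝ (fun w => nearIdentity k u t w ε) z :=
      (hUd.comp z (hasFDerivAt_prodMk_right t z)).differentiableAt
    have hd2 : DifferentiableAt ℝ (v t) z :=
      ((contDiffOn_slice hv t).contDiffAt (hD.mem_nhds hz)).differentiableAt (by simp)
    exact (hd1.hasFDerivAt.add (hd2.hasFDerivAt.const_smul (ε ^ m))).fderiv
  have htd : deriv (fun s => nearIdentity k u s z ε + ε ^ m • v s z) t =
      deriv (fun s => nearIdentity k u s z ε) t + ε ^ m • v' := by
    have hd1 : DifferentiableAt ℝ (fun s => nearIdentity k u s z ε) t :=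
      (hasDerivAt_nearIdentity_comp hD hu (γ := fun _ => z) hz
        (hasDerivAt_const t z) ε).differentiableAt
    exact (hd1.hasDerivAt.add (hv'.const_smul (ε ^ m))).deriv
  have hgs : ∑ i ∈ Finset.Icc 1 k, ε ^ i • (g i z + if i = m then h z else 0) =
      S ε + ε ^ m • h z := by
    simp only [hS, smul_add, smul_ite, smul_zero, Finset.sum_add_distrib,
      Finset.sum_ite_eq', if_pos hm]
  simp only [averagingResidual, nearIdentity_add_single hm]
  rw [hfd, htd, hgs]
  simp only [smul_sub, smul_add, map_add, map_smul, Finset.sum_sub_distrib,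
    _root_.add_apply, _root_.smul_apply]
  abel

include hT hD hF in
/-- Order by order construction of a stroboscopic near-identity transformation. -/
theorem exists_averagingResidual_isLittleO
    (hFT : ∀ i ∈ Finset.Icc 1 k, ∀ t : ℝ, ∀ x ∈ D, F i (t + T) x = F i t x) (m : ℕ) (hm : m ≤ k) :
    ∃ (u : ℕ → ℝ → EuclideanSpace ℝ (Fin n) → EuclideanSpace ℝ (Fin n))
      (g : ℕ → EuclideanSpace ℝ (Fin n) → EuclideanSpace ℝ (Fin n)),
      (∀ i ∈ Finset.Icc 1 k,
        ContDiffOn ℝ ∞ (fun p : ℝ × EuclideanSpace ℝ (Fin n) => u i p.1 p.2) (univ ×ˢ D)) ∧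
      (∀ i ∈ Finset.Icc 1 k, ContDiffOn ℝ ∞ (g i) D) ∧
      (∀ i ∈ Finset.Icc 1 k, ∀ t : ℝ, ∀ z ∈ D, u i (t + T) z = u i t z) ∧
      (∀ i ∈ Finset.Icc 1 k, ∀ z ∈ D, u i 0 z = 0) ∧
      ∀ t, ∀ z ∈ D, (fun ε => averagingResidual k F u g t z ε) =o[𝓝[>] 0] fun ε : ℝ => ε ^ m := by
  induction m with
  | zero =>
    refine ⟨fun _ _ _ => 0, fun _ _ => 0, fun _ _ => contDiffOn_const, fun _ _ => contDiffOn_const,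
      fun _ _ _ _ _ => rfl, fun _ _ _ _ => rfl, fun t z _ => ?_⟩
    have : (fun ε : ℝ => ∑ i ∈ Finset.Icc 1 k, ε ^ i • F i t z) =o[𝓝[>] 0] fun ε => ε ^ 0 :=
      IsLittleO.fun_sum fun i hi =>
        isLittleO_pow_smul_const (by have := Finset.mem_Icc.mp hi; omega) _
    refine this.neg_left.congr_left fun ε => ?_
    simp [averagingResidual, nearIdentity]
  | succ m ih =>
    obtain ⟨u, g, hu, hg, huT, hu0, hres⟩ := ih (by omega)
    have hm1 : m + 1 ∈ Finset.Icc 1 k := Finset.mem_Icc.mpr ⟨by omega, hm⟩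
    have hW := isOpen_nearIdentityDomain hD hu
    have hP := contDiffOn_residual hD hF hu hg
    set c : ℝ × EuclideanSpace ℝ (Fin n) → EuclideanSpace ℝ (Fin n) := fun p =>
      ((m + 1)! : ℝ)⁻¹ • iteratedDeriv (m + 1) (fun ε => averagingResidual k F u g p.1 p.2 ε) 0
      with hc
    have hcs : ContDiffOn ℝ ∞ c (univ ×ˢ D) :=
      ((hP.iteratedDeriv_snd hW (m + 1)).comp (f := fun p => (p, (0 : ℝ))) (by fun_prop)
        (fun p hp => mem_nearIdentityDomain_zero hp.2)).const_smul _
    have hcT : ∀ t, ∀ z ∈ D, c (t + T, z) = c (t, z) := by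
      intro t z hz
      simp only [hc]
      congr 1
      refine Filter.EventuallyEq.iteratedDeriv_eq _ ?_
      have hev : ∀ᶠ ε : ℝ in 𝓝 0, ((t, z), ε) ∈ nearIdentityDomain k u D :=
        (by fun_prop : Continuous fun ε : ℝ => ((t, z), ε)).continuousAt.eventually_mem
          (hW.mem_nhds (mem_nearIdentityDomain_zero (p := (t, z)) hz))
      filter_upwards [hev] with ε hε
      exact averagingResidual_periodic hD hFT huT g t hz hε.2
    -- The homological equation `∂_t v + h = -c` cancels the coefficient of order `m + 1`; choosing
    -- `v(0,·) = 0` preserves the stroboscopic condition.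
    obtain ⟨v, h, hvs, hhs, hvT, hv0, hvd⟩ :=
      exists_periodic_primitive hT hD hcs.neg (fun t z hz => by simp [hcT t z hz])
    refine ⟨fun i t z => u i t z + if i = m + 1 then v t z else 0,
      fun i z => g i z + if i = m + 1 then h z else 0, fun i hi => ?_, fun i hi => ?_,
      fun i hi t z hz => ?_, fun i hi z hz => ?_, fun t z hz => ?_⟩
    · refine (hu i hi).add ?_
      split_ifs
      exacts [hvs, contDiffOn_const]
    · refine (hg i hi).add ?_
      split_ifs
      exacts [hhs, contDiffOn_const]
    · simp only [huT i hi t z hz, hvT t z hz]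
    · simp only [hu0 i hi z hz, hv0 z hz, ite_self, add_zero]
    · have hsm : ContDiffAt ℝ ∞ (fun ε => averagingResidual k F u g t z ε) 0 :=
        (hP.contDiffAt (hW.mem_nhds (mem_nearIdentityDomain_zero (p := (t, z)) hz))).comp
          (0 : ℝ) (f := fun ε => ((t, z), ε)) (by fun_prop)
      refine ((averagingResidual_add_single hD hF hm1 hu g hvs h hz (hvd t z hz)).add
        (isLittleO_leading_term hsm (hres t z hz))).congr_left fun ε => ?_
      rw [sub_add_cancel, smul_neg]
      change _ + (_ - ε ^ (m + 1) • c (t, z)) = _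
      abel

include hT hD hF in
theorem exists_isStroboscopicAveraged
    (hFT : ∀ i ∈ Finset.Icc 1 k, ∀ t : ℝ, ∀ x ∈ D, F i (t + T) x = F i t x) {ε₀ : ℝ}
    (hε₀ : 0 < ε₀)
    {R : ℝ → EuclideanSpace ℝ (Fin n) → ℝ → EuclideanSpace ℝ (Fin n)}
    (hR : ContinuousOn (fun p : ℝ × EuclideanSpace ℝ (Fin n) × ℝ => R p.1 p.2.1 p.2.2)
      (univ ×ˢ D ×ˢ Icc 0 ε₀))
    (hRT : ∀ t : ℝ, ∀ x ∈ D, ∀ ε ∈ Icc 0 ε₀, R (t + T) x ε = R t x ε) :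
    ∃ g, IsStroboscopicAveraged T ε₀ D k F R g := by
  obtain ⟨u, g, hu, hg, huT, hu0, hres⟩ :=
    exists_averagingResidual_isLittleO hT hD hF hFT k le_rfl
  refine ⟨g, u, hu, hg, huT, fun z hz ε _ => ?_, ?_⟩
  · rw [nearIdentity, Finset.sum_eq_zero, add_zero]
    intro i hi
    rw [hu0 i hi z hz, smul_zero]
  set A : ℝ → EuclideanSpace ℝ (Fin n) → ℝ →
      (EuclideanSpace ℝ (Fin n) →L[ℝ] EuclideanSpace ℝ (Fin n)) := fun t z ε =>
    fderiv ℝ (fun w => nearIdentity k u t w ε) z with hA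
  -- This is the transformation identity solved for `r`. At `ε = 0` the quotient takes the default
  -- value `0`, and the identity survives because the residual vanishes there.
  refine ⟨fun t z ε => Ring.inverse (A t z ε) (R t (nearIdentity k u t z ε) ε -
    (1 / ε ^ (k + 1)) • averagingResidual k F u g t z ε), fun K hKD hK => ?_⟩
  obtain ⟨δ₁, hδ₁, C, hC⟩ := residual_uniform_bound hD hF hu hg hres T hKD hK
  have hKT : IsCompact (Icc 0 T ×ˢ K) := isCompact_Icc.prod hK
  obtain ⟨δ₂, hδ₂, hUD⟩ := exists_Icc_subset_of_isCompact hKT (isOpen_nearIdentityDomain hD hu)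
    (fun p hp => mem_nearIdentityDomain_zero (hKD hp.2))
  have hA0 : ∀ t z, A t z 0 = 1 := fun t z => by
    rw [hA]; simp only [nearIdentity_zero]; exact fderiv_fun_id
  -- Within distance `1/2` of the identity, `∂_z U` is invertible with inverse of norm at most `2`;
  -- hence the factor `2` in the bound for `r`.
  obtain ⟨δ₃, hδ₃, hA1⟩ := exists_Icc_subset_of_isCompact hKT
    ((contDiffOn_fderiv_nearIdentity hD hu).continuousOn.isOpen_inter_preimage
      ((isOpen_univ.prod hD).prod isOpen_univ) (Metric.isOpen_ball (x := 1) (ε := 1 / 2)))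
    (fun p hp => ⟨⟨⟨mem_univ _, hKD hp.2⟩, mem_univ _⟩, by
      change A p.1 p.2 0 ∈ Metric.ball 1 (1 / 2)
      rw [hA0]
      exact Metric.mem_ball_self (by norm_num)⟩)
  set ε₁ := min (min δ₁ δ₂) (min δ₃ ε₀) with hε₁
  have hε₁0 : 0 < ε₁ := by positivity
  have hle : ∀ ε ∈ Icc 0 ε₁, (ε ≤ δ₁ ∧ ε ≤ δ₂) ∧ ε ≤ δ₃ ∧ ε ≤ ε₀ := fun ε hε => by
    have := hε.2
    simpa only [hε₁, le_min_iff] using this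
  have hcomp : IsCompact ((Icc 0 T ×ˢ K) ×ˢ Icc 0 ε₁) := hKT.prod isCompact_Icc
  have hsub : ((Icc 0 T ×ˢ K) ×ˢ Icc 0 ε₁) ⊆ ((univ ×ˢ D) ×ˢ univ) :=
    prod_mono (prod_mono (subset_univ _) hKD) (subset_univ _)
  obtain ⟨CR, hCR⟩ := hcomp.exists_bound_of_continuousOn (hR.comp
    (f := fun q : (ℝ × EuclideanSpace ℝ (Fin n)) × ℝ =>
      (q.1.1, nearIdentity k u q.1.1 q.1.2 q.2, q.2))
    (ContinuousOn.prodMk (by fun_prop) (ContinuousOn.prodMk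
      ((contDiffOn_nearIdentity hu).continuousOn.mono hsub) (by fun_prop)))
    (fun q hq => ⟨mem_univ _, (hUD q.1 hq.1 q.2 ⟨hq.2.1, (hle _ hq.2).1.2⟩).2, hq.2.1,
      (hle _ hq.2).2.2⟩))
  have hall : ∀ t, ∀ z ∈ K, ∀ ε ∈ Icc 0 ε₁, nearIdentity k u t z ε ∈ D ∧
      ‖A t z ε - 1‖ ≤ 1 / 2 ∧ ‖averagingResidual k F u g t z ε‖ ≤ C * ε ^ (k + 1) ∧
      ‖R t (nearIdentity k u t z ε) ε‖ ≤ CR := by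
    intro t z hz ε hε
    -- The conjunction of estimates is treated as a periodic proposition in `t`, so bounds obtained
    -- by compactness on one period hold for all real `t`.
    have hper : Function.Periodic (fun t => nearIdentity k u t z ε ∈ D ∧
      ‖A t z ε - 1‖ ≤ 1 / 2 ∧ ‖averagingResidual k F u g t z ε‖ ≤ C * ε ^ (k + 1) ∧
      ‖R t (nearIdentity k u t z ε) ε‖ ≤ CR) T := by
      intro t
      simp only [hA, nearIdentity_periodic huT t (hKD hz),
        fderiv_nearIdentity_periodic hD huT t (hKD hz), eq_iff_iff]
      refine and_congr_right fun hU => ?_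
      rw [averagingResidual_periodic hD hFT huT g t (hKD hz) hU,
        hRT t _ hU ε ⟨hε.1, (hle ε hε).2.2⟩]
    obtain ⟨s, hs, hts⟩ := hper.exists_mem_Ico₀ hT t
    have hs' := Ico_subset_Icc_self hs
    refine (eq_iff_iff.mp hts).mpr ⟨?_, ?_, ?_, ?_⟩
    · exact (hUD (s, z) ⟨hs', hz⟩ ε ⟨hε.1, (hle ε hε).1.2⟩).2
    · have := (hA1 (s, z) ⟨hs', hz⟩ ε ⟨hε.1, (hle ε hε).2.1⟩).2
      exact (mem_ball_iff_norm.mp this).le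
    · exact hC s hs' z hz ε ⟨hε.1, (hle ε hε).1.1⟩
    · exact hCR ((s, z), ε) ⟨⟨hs', hz⟩, hε⟩
  refine ⟨ε₁, ⟨hε₁0, (min_le_right _ _).trans (min_le_right _ _)⟩, 2 * (CR + |C|),
    fun t z hz ε hε => ?_⟩
  obtain ⟨hU, hA2, hPt, hRt⟩ := hall t z hz ε hε
  set P := averagingResidual k F u g t z ε with hP
  set y := R t (nearIdentity k u t z ε) ε - (1 / ε ^ (k + 1)) • P with hy
  have hunit : IsUnit (A t z ε) := by
    have : ‖1 - A t z ε‖ < 1 := by rw [norm_sub_rev]; linarith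
    simpa using (Units.oneSub _ this).isUnit
  have hinv : A t z ε (Ring.inverse (A t z ε) y) = y := by
    rw [← mul_apply_eq_comp, Ring.mul_inverse_cancel _ hunit,
      one_apply_eq_self]
  refine ⟨hU, ?_, ?_⟩
  · have hyn : ‖y‖ ≤ CR + |C| := by
      refine (norm_sub_le _ _).trans (add_le_add hRt ?_)
      rcases hε.1.eq_or_lt with h | h
      · rw [← h]; simp
      · have hp : 0 < ε ^ (k + 1) := by positivity
        rw [norm_smul, Real.norm_of_nonneg (by positivity), one_div, inv_mul_le_iff₀ hp]
        refine hPt.trans ?_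
        rw [mul_comm]
        exact mul_le_mul_of_nonneg_left (le_abs_self C) hp.le
    set x := Ring.inverse (A t z ε) y with hx
    have h1 : ‖(A t z ε - 1) x‖ ≤ 1 / 2 * ‖x‖ := (A t z ε - 1).le_of_opNorm_le hA2 x
    have h2 : x = y - (A t z ε - 1) x := by
      rw [_root_.sub_apply, hinv, one_apply_eq_self]
      abel
    have h3 : ‖x‖ ≤ ‖y‖ + ‖(A t z ε - 1) x‖ := by
      conv_lhs => rw [h2]
      exact norm_sub_le _ _
    linarith
  · change _ + A t z ε (_ + ε ^ (k + 1) • Ring.inverse (A t z ε) y) = _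
    rw [map_add, map_smul, hinv, perturbedField, hy, smul_sub, smul_smul]
    have hPz : (ε ^ (k + 1) * (1 / ε ^ (k + 1))) • P = P := by
      rcases hε.1.eq_or_lt with h | h
      · have hP0 : P = 0 := by
          rw [← h] at hPt
          simpa using hPt
        rw [hP0, smul_zero]
      · rw [mul_one_div_cancel (by positivity), one_smul]
    rw [hPz, hP, averagingResidual]
    abel

end

end

/-! ### The proposition. -/

theorem mainTheorem1 {n : ℕ} (k : ℕ) (T ε₀ : ℝ) (hT : 0 < T) (hε₀ : 0 < ε₀)
    (D : Set (EuclideanSpace ℝ (Fin n))) (hD : IsOpen D)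
    (F : ℕ → ℝ → EuclideanSpace ℝ (Fin n) → EuclideanSpace ℝ (Fin n))
    (hF : ∀ i ∈ Finset.Icc 1 k,
      ContDiffOn ℝ ∞ (fun p : ℝ × EuclideanSpace ℝ (Fin n) => F i p.1 p.2) (univ ×ˢ D))
    (hFT : ∀ i ∈ Finset.Icc 1 k, ∀ t : ℝ, ∀ x ∈ D, F i (t + T) x = F i t x)
    (R : ℝ → EuclideanSpace ℝ (Fin n) → ℝ → EuclideanSpace ℝ (Fin n))
    (hR : ContinuousOn (fun p : ℝ × EuclideanSpace ℝ (Fin n) × ℝ => R p.1 p.2.1 p.2.2)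
      (univ ×ˢ D ×ˢ Icc 0 ε₀))
    (hRT : ∀ t : ℝ, ∀ x ∈ D, ∀ ε ∈ Icc 0 ε₀, R (t + T) x ε = R t x ε) :
    (∃ g, IsStroboscopicAveraged T ε₀ D k F R g) ∧
    ∀ g, IsStroboscopicAveraged T ε₀ D k F R g → ∀ ℓ ∈ Finset.Icc 2 k,
      ((∀ i ∈ Finset.Icc 1 (ℓ - 1), ∀ z ∈ D, melnikov T F i z = 0) ∨
        (∀ i ∈ Finset.Icc 1 (ℓ - 1), ∀ z ∈ D, g i z = 0)) →
      (∀ i ∈ Finset.Icc 1 (2 * ℓ - 1), i ≤ k → ∀ z ∈ D, melnikov T F i z = T • g i z) ∧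
      (2 * ℓ ≤ k → ∀ z ∈ D,
        g (2 * ℓ) z = (1 / T) • (melnikov T F (2 * ℓ) z -
          (1 / 2 : ℝ) • fderiv ℝ (melnikov T F ℓ) z (melnikov T F ℓ z)) ∧
        melnikov T F (2 * ℓ) z =
          T • g (2 * ℓ) z + (T ^ 2 / 2) • fderiv ℝ (g ℓ) z (g ℓ z)) := by
  refine ⟨exists_isStroboscopicAveraged hT hD hF hFT hε₀ hR hRT, ?_⟩
  rintro g ⟨u, hu⟩ ℓ hℓ h
  rw [Finset.mem_Icc] at hℓ
  have hg := hu.smooth_g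
  have key : ∀ p ∈ Finset.Icc 1 k, (∀ i ∈ Finset.Icc 1 (p - 1), ∀ z ∈ D, g i z = 0) →
      ∀ i ∈ Finset.Icc 1 k, i ≤ 2 * p → ∀ z ∈ D,
        melnikov T F i z = averagedCoeff p g i T z := fun p hp h0 i hi hip z hz =>
    melnikov_eq_averagedCoeff hD hg hp hT hF hR hu h0 hz hi hip
  have hg0 : ∀ i ∈ Finset.Icc 1 (ℓ - 1), ∀ z ∈ D, g i z = 0 := by
    rcases h with h | h
    -- Once the lower `g_j` vanish, the comparison with `p = i` gives `f_i = T g_i`, as `i ≠ 2i`; so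
    -- `f_i = 0` forces `g_i = 0`.
    · intro i
      induction i using Nat.strong_induction_on with
      | _ i ih =>
        intro hi z hz
        have hi' := Finset.mem_Icc.mp hi
        have hik : i ∈ Finset.Icc 1 k := Finset.mem_Icc.mpr ⟨hi'.1, by omega⟩
        have := key i hik (fun j hj => ih j (by rw [Finset.mem_Icc] at hj; omega)
          (by rw [Finset.mem_Icc] at hj ⊢; omega)) i hik (by omega) z hz
        rw [h i hi z hz, averagedCoeff, if_neg (by omega), add_zero] at this
        exact (smul_eq_zero.mp this.symm).resolve_left hT.ne'
    · exact h
  have hkey := key ℓ (Finset.mem_Icc.mpr ⟨by omega, hℓ.2⟩) hg0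
  have hlow : ∀ i ∈ Finset.Icc 1 (2 * ℓ - 1), i ≤ k → ∀ z ∈ D, melnikov T F i z = T • g i z := by
    intro i hi hik z hz
    rw [Finset.mem_Icc] at hi
    rw [hkey i (Finset.mem_Icc.mpr ⟨hi.1, hik⟩) (by omega) z hz, averagedCoeff,
      if_neg (by omega), add_zero]
  refine ⟨hlow, fun hk z hz => ?_⟩
  have h2 : melnikov T F (2 * ℓ) z =
      T • g (2 * ℓ) z + (T ^ 2 / 2) • fderiv ℝ (g ℓ) z (g ℓ z) := by
    rw [hkey (2 * ℓ) (Finset.mem_Icc.mpr ⟨by omega, hk⟩) le_rfl z hz, averagedCoeff, if_pos rfl]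
  refine ⟨?_, h2⟩
  have hℓlow := hlow ℓ (Finset.mem_Icc.mpr ⟨by omega, by omega⟩) hℓ.2
  -- Since `ℓ ≤ 2ℓ - 1`, the equality `f_ℓ = T g_ℓ` holds on a neighbourhood of `z` and may be
  -- differentiated; then `½ df_ℓ·f_ℓ = (T²/2) dg_ℓ·g_ℓ`.
  have hd : fderiv ℝ (melnikov T F ℓ) z = T • fderiv ℝ (g ℓ) z := by
    have hev : melnikov T F ℓ =ᶠ[𝓝 z] T • g ℓ := by
      filter_upwards [hD.mem_nhds hz] with w hw using hℓlow w hw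
    rw [hev.fderiv_eq, fderiv_const_smul]
    exact ((hg ℓ (Finset.mem_Icc.mpr ⟨by omega, hℓ.2⟩)).contDiffAt
      (hD.mem_nhds hz)).differentiableAt (by simp)
  rw [h2, hd, hℓlow z hz, _root_.smul_apply, map_smul, smul_smul, smul_smul]
  rw [show 1 / 2 * T * T = T ^ 2 / 2 by ring, add_sub_cancel_right, smul_smul,
    one_div_mul_cancel hT.ne', one_smul]
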